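/- Let $q$ be a prime power, let $\mathrm{Tr},\mathrm{N}:\mathbb{F}_{q^3}\to\mathbb{F}_q$ be the trace and norm maps, and let $V=\mathbb{F}_q\times\mathbb{F}_{q^3}\times\mathbb{F}_{q^3}\times\mathbb{F}_q$, an $8$-dimensional $\mathbb{F}_q$-vector space with point set $\mathrm{PG}(V)=\mathrm{PG}(7,q)$ of its projective space. Let $$A\big((x,y,z,w),(x',y',z',w')\big)=xw'-wx'+\mathrm{Tr}(zy'-yz'),$$ and for $0\neq v\in V$ put $v^\perp=\{\langle u\rangle\in\mathrm{PG}(V): A(u,v)=0\}$. Let $G=\mathrm{PGL}(2,q^3)$ act on $\mathrm{PG}(V)$ as follows: the class of $g=\begin{pmatrix}a&b\\c&d\end{pmatrix}\in \mathrm{GL}(2,q^3)$ maps $\langle(x,y,z,w)\rangle$ to $\langle(x',y',z',w')\rangle$, where $$\begin{aligned} x'&=\mathrm{N}(d)x+\mathrm{N}(c)w+\mathrm{Tr}(cd^{q^2+q}y+dc^{q^2+q}z),\\ y'&=bd^{q^2+q}x+ac^{q^2+q}w+ad^{q^2+q}y+bd^{q^2}c^qy^q+bd^qc^{q^2}y^{q^2}+bc^{q^2+q}z+d^qac^{q^2}z^q+d^{q^2}ac^qz^{q^2},\\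 z'&=db^{q^2+q}x+ca^{q^2+q}w+cb^{q^2+q}y+db^{q^2}a^qy^q+db^qa^{q^2}y^{q^2}+da^{q^2+q}z+b^qca^{q^2}z^q+b^{q^2}ca^qz^{q^2},\\ w'&=\mathrm{N}(b)x+\mathrm{N}(a)w+\mathrm{Tr}(ab^{q^2+q}y+ba^{q^2+q}z). \end{aligned}$$ Let $O=\{\langle(1,x,x^{q+q^2},\mathrm{N}(x))\rangle:x\in\mathbb{F}_{q^3}\}\cup\{\langle(0,0,0,1)\rangle\}$. There exist elements $\alpha\in\mathbb{F}_q$ such that $X^2-X-\alpha\in\mathbb{F}_q[X]$ is irreducible. There are exactly four $G$-orbits $O_1,O_2,O_3,O_4$ on $\mathrm{PG}(V)$. They can be labelled so that $O_1=O$ and so that the following table holds, where $\alpha$ is any element of $\mathbb{F}_q$ with $X^2-X-\alpha$ irreducible (the orbits do not depend on its choice) and the last column gives the value of $|v^\perp\cap O|$ for every nonzero $v\in V$ with $\langle v\rangle$ in the orbit: $$\begin{array}{cccc} \text{orbit}&\text{size}&\text{contains}&|v^\perp\cap O|\\ \hline O_1&q^3+1&\langle(1,0,0,0)\rangle&1\\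 O_2&q(q^2+q+1)(q^3+1)&\langle(0,0,1,0)\rangle&q^2+1\\ O_3&\tfrac12q^3(q^3+1)(q-1)&\langle(1,0,0,1)\rangle&q^2+q+1\\ O_4&\tfrac12q^3(q^3-1)(q+1)&\langle(1,0,\alpha,\alpha)\rangle&q^2-q+1 \end{array}$$ -/

import Mathlib

open scoped LinearAlgebra.Projectivization

noncomputable section

namespace PGLModule

variable (F K : Type*) [Field F] [Field K] [Algebra F K]

/-- The `F`-vector space `V = F × K × K × F`, with elements `(x, y, z, w)`. -/
abbrev V : Type _ := F × K × K × F

variable {F K}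

theorem V_ext {u v : V F K} (h1 : algebraMap F K u.1 = algebraMap F K v.1)
    (h2 : u.2.1 = v.2.1) (h3 : u.2.2.1 = v.2.2.1)
    (h4 : algebraMap F K u.2.2.2 = algebraMap F K v.2.2.2) : u = v :=
  Prod.ext ((algebraMap F K).injective h1)
    (Prod.ext h2 (Prod.ext h3 ((algebraMap F K).injective h4)))

/-- The alternating form `A((x,y,z,w),(x',y',z',w')) = xw' - wx' + Tr(zy' - yz')` on `V`. -/
def A (u v : V F K) : F :=
  u.1 * v.2.2.2 - u.2.2.2 * v.1 + Algebra.trace F K (u.2.2.1 * v.2.1 - u.2.1 * v.2.2.1)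

/-- The hyperplane `v^⊥ = {⟨x⟩ : A(x, v) = 0}`, as a set of points of `PG(V)`. -/
def perp (v : V F K) : Set (ℙ F (V F K)) :=
  {p | ∃ (x : V F K) (hx : x ≠ 0), p = Projectivization.mk F x hx ∧ A x v = 0}

variable [Fintype F]

/-- The point set `O = {⟨(1, x, x^(q+q²), N(x))⟩ : x ∈ K} ∪ {⟨(0,0,0,1)⟩}` of `PG(V)`, where
`q = |F|`. -/
def O : Set (ℙ F (V F K)) :=
  Set.range (fun x : K => Projectivization.mk F
    ((1, x, x ^ (Fintype.card F + Fintype.card F ^ 2), Algebra.norm F x) : V F K) (by simp)) ∪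
  {Projectivization.mk F ((0, 0, 0, 1) : V F K) (by simp)}

/-- The map of `V` attached to the matrix `(a b; c d)` over `K`, where `q = |F|`. -/
def act (a b c d : K) (v : V F K) : V F K :=
  let q := Fintype.card F
  let x := algebraMap F K v.1
  let y := v.2.1
  let z := v.2.2.1
  let w := algebraMap F K v.2.2.2
  ( Algebra.norm F d * v.1 + Algebra.norm F c * v.2.2.2
      + Algebra.trace F K (c * d ^ (q ^ 2 + q) * y + d * c ^ (q ^ 2 + q) * z),
    b * d ^ (q ^ 2 + q) * x + a * c ^ (q ^ 2 + q) * w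
      + a * d ^ (q ^ 2 + q) * y + b * d ^ q ^ 2 * c ^ q * y ^ q + b * d ^ q * c ^ q ^ 2 * y ^ q ^ 2
      + b * c ^ (q ^ 2 + q) * z + d ^ q * a * c ^ q ^ 2 * z ^ q + d ^ q ^ 2 * a * c ^ q * z ^ q ^ 2,
    d * b ^ (q ^ 2 + q) * x + c * a ^ (q ^ 2 + q) * w
      + c * b ^ (q ^ 2 + q) * y + d * b ^ q ^ 2 * a ^ q * y ^ q + d * b ^ q * a ^ q ^ 2 * y ^ q ^ 2
      + d * a ^ (q ^ 2 + q) * z + b ^ q * c * a ^ q ^ 2 * z ^ q + b ^ q ^ 2 * c * a ^ q * z ^ q ^ 2,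
    Algebra.norm F b * v.1 + Algebra.norm F a * v.2.2.2
      + Algebra.trace F K (a * b ^ (q ^ 2 + q) * y + b * a ^ (q ^ 2 + q) * z) )

/-! ### The formulas above define an action of `PGL(2, K)` on `PG(V)` -/

theorem pow_q (x : K) : x ^ Fintype.card F = FiniteField.frobeniusAlgHom F K x := rfl

theorem pow_q2 (x : K) : x ^ Fintype.card F ^ 2 =
    FiniteField.frobeniusAlgHom F K (FiniteField.frobeniusAlgHom F K x) := by
  rw [← pow_q, ← pow_q, ← pow_mul, sq]

section
variable [Fact (Module.finrank F K = 3)]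

theorem frob_frob_frob (x : K) : FiniteField.frobeniusAlgHom F K
    (FiniteField.frobeniusAlgHom F K (FiniteField.frobeniusAlgHom F K x)) = x := by
  have h3 : Module.finrank F K = 3 := Fact.out
  have : FiniteDimensional F K := Module.finite_of_finrank_pos (by omega)
  have : Finite K := Module.finite_of_finite F
  have h := pow_orderOf_eq_one (FiniteField.frobeniusAlgHom F K)
  rw [FiniteField.orderOf_frobeniusAlgHom, h3] at h
  have := congrArg (fun f : K →ₐ[F] K => f x) h
  simpa [pow_succ] using this

theorem trace_eq (x : K) : algebraMap F K (Algebra.trace F K x) =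
    x + FiniteField.frobeniusAlgHom F K x +
      FiniteField.frobeniusAlgHom F K (FiniteField.frobeniusAlgHom F K x) := by
  have h3 : Module.finrank F K = 3 := Fact.out
  have : FiniteDimensional F K := Module.finite_of_finrank_pos (by omega)
  have : Finite K := Module.finite_of_finite F
  rw [FiniteField.algebraMap_trace_eq_sum_pow, h3]
  simp only [Finset.sum_range_succ, Finset.sum_range_zero, Nat.card_eq_fintype_card, pow_zero,
    pow_one, pow_q, pow_q2, zero_add]

theorem norm_eq (x : K) : algebraMap F K (Algebra.norm F x) =
    x * FiniteField.frobeniusAlgHom F K x *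
      FiniteField.frobeniusAlgHom F K (FiniteField.frobeniusAlgHom F K x) := by
  have h3 : Module.finrank F K = 3 := Fact.out
  have : FiniteDimensional F K := Module.finite_of_finrank_pos (by omega)
  have : Finite K := Module.finite_of_finite F
  rw [FiniteField.algebraMap_norm_eq_prod_pow, h3]
  simp only [Finset.prod_range_succ, Finset.prod_range_zero, Nat.card_eq_fintype_card, pow_zero,
    pow_one, pow_q, pow_q2, one_mul]

theorem act_add (a b c d : K) (u v : V F K) :
    act a b c d (u + v) = act a b c d u + act a b c d v := by
  apply V_ext <;>
  · simp only [act, Prod.fst_add, Prod.snd_add, pow_add, pow_q, pow_q2, map_add, map_mul,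
      trace_eq, norm_eq]
    ring

theorem act_smul (a b c d : K) (r : F) (v : V F K) :
    act a b c d (r • v) = r • act a b c d v := by
  apply V_ext <;>
  · simp only [act, Prod.smul_fst, Prod.smul_snd]
    simp only [pow_add, pow_q, pow_q2, map_add, map_mul,
      trace_eq, norm_eq, Algebra.smul_def, AlgHom.commutes, Algebra.algebraMap_self,
      RingHom.id_apply]
    ring

theorem act_scalar (a : K) (v : V F K) : act a 0 0 a v = Algebra.norm F a • v := by
  apply V_ext <;>
  · simp only [act, Prod.smul_fst, Prod.smul_snd]
    simp only [pow_add, pow_q, pow_q2, map_add, map_mul,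
      trace_eq, norm_eq, Algebra.smul_def, Algebra.algebraMap_self,
      RingHom.id_apply, map_zero]
    ring

set_option maxHeartbeats 4000000 in
theorem act_act (a b c d a' b' c' d' : K) (v : V F K) :
    act a b c d (act a' b' c' d' v) =
      act (a * a' + b * c') (a * b' + b * d') (c * a' + d * c') (c * b' + d * d') v := by
  apply V_ext <;>
  · simp only [act, pow_add, pow_q, pow_q2, map_add, map_mul,
      trace_eq, norm_eq, AlgHom.commutes, frob_frob_frob]
    ring

/-- The matrix monoid acts `F`-linearly on `V`. -/
def repEnd : Matrix (Fin 2) (Fin 2) K →* Module.End F (V F K) where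
  toFun g :=
    { toFun := act (g 0 0) (g 0 1) (g 1 0) (g 1 1)
      map_add' := act_add _ _ _ _
      map_smul' := act_smul _ _ _ _ }
  map_one' := by
    refine LinearMap.ext fun v => ?_
    simpa using act_scalar (1 : K) v
  map_mul' g h := by
    refine LinearMap.ext fun v => ?_
    simpa [Matrix.mul_apply, Fin.sum_univ_two] using
      (act_act (g 0 0) (g 0 1) (g 1 0) (g 1 1) (h 0 0) (h 0 1) (h 1 0) (h 1 1) v).symm

/-- The resulting representation of `GL(2, K)` on `V`. -/
def rep : GL (Fin 2) K →* LinearMap.GeneralLinearGroup F (V F K) := Units.map repEnd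

/-- The homomorphism from `PGL(2, K)` to the permutations of `PG(V)`, obtained from `rep`:
scalar matrices act as scalars on `V`, hence trivially on `PG(V)`. -/
def toPerm : Matrix.ProjGenLinGroup (Fin 2) K →* Equiv.Perm (ℙ F (V F K)) :=
  Matrix.ProjGenLinGroup.lift
    ((MulAction.toPermHom (LinearMap.GeneralLinearGroup F (V F K)) (ℙ F (V F K))).comp rep) <| by
    ext u p
    induction p using Projectivization.ind with | _ v hv =>
    refine (Projectivization.mk_eq_mk_iff' F _ _ _ _).2 ⟨Algebra.norm F (u : K), ?_⟩
    change _ = act (Matrix.GeneralLinearGroup.scalar (Fin 2) u 0 0)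
      (Matrix.GeneralLinearGroup.scalar (Fin 2) u 0 1)
      (Matrix.GeneralLinearGroup.scalar (Fin 2) u 1 0)
      (Matrix.GeneralLinearGroup.scalar (Fin 2) u 1 1) v
    simpa using (act_scalar (u : K) v).symm

/-- The action of `PGL(2, K)` on the points of `PG(V)`. -/
instance : MulAction (Matrix.ProjGenLinGroup (Fin 2) K) (ℙ F (V F K)) :=
  MulAction.compHom _ (toPerm (F := F))

theorem act_ne_zero (g : GL (Fin 2) K) {v : V F K} (hv : v ≠ 0) :
    act (g 0 0) (g 0 1) (g 1 0) (g 1 1) v ≠ 0 :=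
  (smul_ne_zero_iff_ne (rep (F := F) g)).2 hv

theorem mk_smul_mk (g : GL (Fin 2) K) {v : V F K} (hv : v ≠ 0) :
    Matrix.ProjGenLinGroup.mk g • Projectivization.mk F v hv =
      Projectivization.mk F (act (g 0 0) (g 0 1) (g 1 0) (g 1 1) v) (act_ne_zero g hv) :=
  rfl

end

end PGLModule

end

/-!
Write `σ` for the `q`-Frobenius of `K` and `Q = q³ = |K|`. Over an algebraic closure `V` becomes the
tensor cube of the natural module, on which `g` acts as `g ⊗ g^σ ⊗ g^(σ²)`, and `O` consists of the
rational pure tensors (`veronese`). It is a copy of the projective line `K ∪ {∞}` on which `PGL(2, K)`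
acts 2-transitively, and `A` is preserved up to the factor `N(det g)` (`A_act`), so the section number
`|v^⊥ ∩ O|` (`sectionCard`) is constant on orbits.

*Sizes.* `O` is parametrized by `K ∪ {∞}`. The stabilizers of `⟨(0,0,1,0)⟩` and `⟨(1,0,0,1)⟩` in
`GL(2, K)` are computed outright (`act_e3_eq_smul_iff`, `act_e1_add_e4_eq_smul_iff`), which gives the
sizes of the next two orbits. Their section numbers count the elements of `K` of trace `0`, together
with `∞`, and the elements of norm `1`. The three section numbers differ, so the orbits are disjoint,
and the size of the set `remainingPoints` of the points outside them follows by subtraction.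

*The remaining section numbers.* Since `O` is 2-transitive, the first two moments of the section
number over all vectors of `V` can be computed (`sum_sectionCard`, `sum_sectionCard_sq`). After
removing the contribution of the three known orbits, the sum of `(|v^⊥ ∩ O| - (q² - q + 1))²` over the
remaining points is `0`, so each of them has section number exactly `q² - q + 1`
(`sectionCard_of_mem_remainingPoints`).

*The remaining points form one orbit.* That number is positive, so a remaining point can be moved to
one whose perp contains `∞`, and then by the affine group to `⟨(0,1,z,w)⟩` with `z, w ∈ F`
(`exists_normalForm`). If `X² - zX + (z² - w)` has roots `s, t` in `F`, such a point lies on the line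
joining the points of `O` with parameters `s ≠ t`, or is tangent to `O` when `s = t`, which the
definition of the remaining points excludes. Otherwise this quadratic is irreducible, and two
irreducible quadratics over a finite field are related by an affine substitution over `F`, because
both have their roots in the same quadratic extension; this substitution is realized in `PGL(2, K)`
(`mem_orbit_normalForm`). Finally `⟨(1,0,α,α)⟩` is a remaining point: an element of the group carrying
one of the first three representatives to it would produce a root of `X² - X - α` in `F`
(`mk_mem_remainingPoints`).
-/

open scoped Pointwise

noncomputable section

namespace PGLModule

/-! ### Irreducible quadratics over a finite field -/

section Quadratic
open Polynomial

theorem irreducible_quadratic {F : Type*} [Field F] {p r : F} (h : ∀ x, x ^ 2 - p * x + r ≠ 0) :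
    Irreducible (X ^ 2 - C p * X + C r) := by
  have hdeg : (X ^ 2 - C p * X + C r).natDegree = 2 := by compute_degree!
  refine irreducible_of_degree_le_three_of_not_isRoot (by simp [hdeg]) fun x hx => h x ?_
  simpa using hx

/-- Two irreducible quadratics over a finite field are related by an affine substitution: a root
of the second is `a * β + b` for `β` a root of the first. -/
theorem exists_affine_of_irreducible_quadratic {F : Type*} [Field F] [Finite F] {p r p' r' : F}
    (h : ∀ x, x ^ 2 - p * x + r ≠ 0) (h' : ∀ x, x ^ 2 - p' * x + r' ≠ 0) :
    ∃ a b : F, a ≠ 0 ∧ p' = a * p + 2 * b ∧ r' = a ^ 2 * r + a * b * p + b ^ 2 := by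
  have hdeg : ∀ p r : F, (X ^ 2 - C p * X + C r).natDegree = 2 := fun p r => by compute_degree!
  have hmonic : ∀ p r : F, (X ^ 2 - C p * X + C r).Monic := fun p r => by monicity!
  have := Fact.mk (irreducible_quadratic h)
  have := Fact.mk (irreducible_quadratic h')
  set f := X ^ 2 - C p * X + C r with hf
  set f' := X ^ 2 - C p' * X + C r' with hf'
  have hfin : ∀ p r : F, Module.finrank F (AdjoinRoot (X ^ 2 - C p * X + C r)) = 2 := fun p r => by
    rw [(AdjoinRoot.powerBasis' (hmonic p r)).finrank, AdjoinRoot.powerBasis'_dim, hdeg]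
  have := Module.finite_of_finrank_pos (R := F) (M := AdjoinRoot f) (by rw [hfin]; omega)
  have := Module.finite_of_finrank_pos (R := F) (M := AdjoinRoot f') (by rw [hfin]; omega)
  have : Finite (AdjoinRoot f) := Module.finite_of_finite F
  -- Finite extensions of `F` of equal degree embed into each other.
  obtain ⟨φ⟩ := FiniteField.nonempty_algHom_of_finrank_dvd (F := F) (K := AdjoinRoot f')
    (L := AdjoinRoot f) (by rw [hfin, hfin])
  obtain ⟨β, hβ⟩ : ∃ β, β = AdjoinRoot.root f := ⟨_, rfl⟩
  let ι := algebraMap F (AdjoinRoot f)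
  have hroot : ∀ p r : F, AdjoinRoot.root (X ^ 2 - C p * X + C r) ^ 2 -
      algebraMap F _ p * AdjoinRoot.root (X ^ 2 - C p * X + C r) + algebraMap F _ r = 0 := by
    intro p r
    generalize hg : X ^ 2 - C p * X + C r = g
    have h0 : aeval (AdjoinRoot.root g) (X ^ 2 - C p * X + C r) = 0 := by
      rw [hg, AdjoinRoot.aeval_eq, AdjoinRoot.mk_self]
    simpa only [map_add, map_sub, map_mul, map_pow, aeval_X, aeval_C] using h0
  have hβ1 : β ^ 2 - ι p * β + ι r = 0 := by
    rw [hβ]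
    exact hroot p r
  have hβ2 : φ (AdjoinRoot.root f') ^ 2 - ι p' * φ (AdjoinRoot.root f') + ι r' = 0 := by
    have h0 : AdjoinRoot.root f' ^ 2 - algebraMap F (AdjoinRoot f') p' * AdjoinRoot.root f' +
        algebraMap F (AdjoinRoot f') r' = 0 := hroot p' r'
    simpa only [map_add, map_sub, map_mul, map_pow, map_zero, AlgHom.commutes] using congrArg φ h0
  obtain ⟨a, b, hab⟩ : ∃ a b : F, φ (AdjoinRoot.root f') = ι a * β + ι b := by
    obtain ⟨g, hg⟩ := AdjoinRoot.mk_surjective (φ (AdjoinRoot.root f'))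
    have hlt : (g %ₘ f).natDegree < f.natDegree :=
      natDegree_modByMonic_lt g (hmonic p r) fun h1 => by
        have := hdeg p r
        rw [← hf, h1] at this
        simp at this
    obtain ⟨a, b, hab⟩ := exists_eq_X_add_C_of_natDegree_le_one (p := g %ₘ f)
      (by rw [hf, hdeg] at hlt; exact Nat.lt_succ_iff.1 hlt)
    refine ⟨a, b, ?_⟩
    rw [← hg, ← modByMonic_add_div g f, hab, hβ]
    simp [ι, AdjoinRoot.algebraMap_eq]
  -- `β` and `1` are linearly independent, since `β` does not lie in `F`.
  have hind : ∀ u v : F, ι u * β + ι v = 0 → u = 0 ∧ v = 0 := by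
    intro u v huv
    have hu : u = 0 := by
      by_contra hu
      apply h (-v / u)
      apply ι.injective
      have hu' : ι u ≠ 0 := by simpa using hu
      have : β = ι (- v / u) := by
        rw [map_div₀, map_neg, eq_div_iff hu']
        linear_combination huv
      rw [map_zero, ← hβ1, this]
      simp only [map_add, map_sub, map_mul, map_pow]
    refine ⟨hu, ι.injective ?_⟩
    simpa [hu] using huv
  have ha : a ≠ 0 := by
    rintro rfl
    apply h' b
    apply ι.injective
    simpa [hab] using hβ2
  rw [hab] at hβ2
  obtain ⟨h1, h2⟩ := hind (a ^ 2 * p + 2 * a * b - p' * a) (- a ^ 2 * r + b ^ 2 - p' * b + r') (by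
    simp only [map_add, map_sub, map_mul, map_neg, map_pow, map_ofNat]
    linear_combination hβ2 - ι a ^ 2 * hβ1)
  have hp : p' = a * p + 2 * b := by
    apply mul_left_cancel₀ ha
    linear_combination -h1
  refine ⟨a, b, ha, hp, ?_⟩
  linear_combination h2 + b * hp

theorem exists_irreducible_artinSchreier (F : Type*) [Field F] [Finite F] :
    ∃ α : F, Irreducible (X ^ 2 - X - C α) := by
  -- `x ↦ x² - x` identifies `0` and `1`, so on a finite field it misses some value `α`.
  have hni : ¬ Function.Injective fun x : F => x ^ 2 - x := fun h =>
    zero_ne_one (h (a₁ := 0) (a₂ := 1) (by simp))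
  rw [Finite.injective_iff_surjective, Function.Surjective] at hni
  push Not at hni
  obtain ⟨α, hα⟩ := hni
  refine ⟨α, ?_⟩
  have := irreducible_quadratic (p := 1) (r := -α) fun x hx => hα x (by linear_combination hx)
  simpa [sub_eq_add_neg] using this

theorem ne_zero_of_irreducible_artinSchreier {F : Type*} [Field F] {α : F}
    (h : Irreducible (X ^ 2 - X - C α)) (x : F) : x ^ 2 - x - α ≠ 0 := by
  intro hx
  have hdeg : (X ^ 2 - X - C α).natDegree = 2 := by compute_degree!
  have h1 : (X ^ 2 - X - C α).IsRoot x := by simpa using hx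
  have := natDegree_eq_of_degree_eq_some (degree_eq_one_of_irreducible_of_root h h1)
  rw [hdeg] at this
  norm_num at this

end Quadratic

/-! ### Two counting identities -/

theorem card_subtype_option {α : Type*} [Finite α] (P : Option α → Prop) [Decidable (P none)] :
    Nat.card {t // P t} = (if P none then 1 else 0) + Nat.card {t // P (some t)} := by
  classical
  have := Fintype.ofFinite α
  simp only [Nat.card_eq_fintype_card, Fintype.card_subtype, Finset.card_filter,
    Fintype.sum_option]
  congr!

theorem ncard_eq_card_filter {α : Type*} [Fintype α] (S : Set α) [DecidablePred (· ∈ S)] :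
    S.ncard = (Finset.univ.filter (· ∈ S)).card := by
  rw [← Set.ncard_coe_finset]
  simp

/-! ### Pure vectors and the orbit `O` -/

theorem finiteDimensional (F K : Type*) [Field F] [Field K] [Algebra F K]
    [Fact (Module.finrank F K = 3)] : FiniteDimensional F K :=
  Module.finite_of_finrank_pos (by rw [(Fact.out : Module.finrank F K = 3)]; omega)

attribute [local instance] finiteDimensional

theorem finite_extension (F K : Type*) [Field F] [Fintype F] [Field K] [Algebra F K]
    [Fact (Module.finrank F K = 3)] : Finite K :=
  have := finiteDimensional F K
  Module.finite_of_finite F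

section

variable {F K : Type*} [Field F] [Fintype F] [Field K] [Algebra F K]

local notation "σ" => FiniteField.frobeniusAlgHom F K

/-- The pure vector `(N(c), a·c^(q+q²), c·a^(q+q²), N(a))` with homogeneous coordinates `(a : c)`
on the projective line; over an algebraic closure it is the pure tensor of `(a, c)` and its two
conjugates. The points it spans are those of `O`. -/
def veronese (a c : K) : V F K :=
  (Algebra.norm F c, a * (σ c * σ (σ c)), c * (σ a * σ (σ a)), Algebra.norm F a)

variable [Fact (Module.finrank F K = 3)]

theorem veronese_zero_one : veronese (0 : K) 1 = ((1, 0, 0, 0) : V F K) := by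
  simp [veronese]

theorem veronese_one_zero : veronese (1 : K) 0 = ((0, 0, 0, 1) : V F K) := by
  simp [veronese]

theorem veronese_ne_zero {a c : K} (h : a ≠ 0 ∨ c ≠ 0) : (veronese a c : V F K) ≠ 0 := by
  intro h0
  simp only [veronese, Prod.ext_iff, Prod.fst_zero, Prod.snd_zero, Algebra.norm_eq_zero_iff] at h0
  tauto

theorem act_veronese (a b c d p r : K) :
    act a b c d (veronese p r : V F K) = veronese (a * p + b * r) (c * p + d * r) := by
  apply V_ext <;>
  · simp only [act, veronese, pow_add, pow_q, pow_q2, map_add, map_mul,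
      trace_eq, norm_eq, frob_frob_frob]
    ring

theorem veronese_mul (k a c : K) :
    (veronese (k * a) (k * c) : V F K) = Algebra.norm F k • veronese a c := by
  apply V_ext <;>
  · simp only [veronese, Prod.smul_fst, Prod.smul_snd]
    simp only [smul_eq_mul, map_mul, norm_eq, Algebra.smul_def] <;> ring

/-- `A` is a semi-invariant of the group, of weight `N(det)`. -/
theorem A_act (a b c d : K) (u v : V F K) :
    A (act a b c d u) (act a b c d v) = Algebra.norm F (a * d - b * c) * A u v := by
  apply (algebraMap F K).injective
  simp only [A, act, pow_add, pow_q, pow_q2, map_add, map_sub, map_mul,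
      trace_eq, norm_eq, AlgHom.commutes, frob_frob_frob]
  ring

/-- Homogeneous coordinates for the points of the projective line `K ∪ {∞}`, with `none` as `∞`. -/
def homCoord : Option K → K × K
  | none => (1, 0)
  | some t => (t, 1)

theorem homCoord_ne_zero (t : Option K) : (homCoord t).1 ≠ 0 ∨ (homCoord t).2 ≠ 0 := by
  cases t <;> simp [homCoord]

theorem homCoord_det_ne_zero {s t : Option K} (h : s ≠ t) :
    (homCoord s).1 * (homCoord t).2 - (homCoord t).1 * (homCoord s).2 ≠ 0 := by
  cases s <;> cases t <;> simp_all [homCoord, sub_eq_zero]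

/-- A representative of the point of `O` with parameter `t` in the projective line. -/
def pt (t : Option K) : V F K := veronese (homCoord t).1 (homCoord t).2

theorem pt_ne_zero (t : Option K) : (pt t : V F K) ≠ 0 := veronese_ne_zero (homCoord_ne_zero t)

theorem pt_none : pt (none : Option K) = ((0, 0, 0, 1) : V F K) := veronese_one_zero

omit [Fact (Module.finrank F K = 3)] in
theorem pt_some (t : K) : pt (some t) = ((1, t, σ t * σ (σ t), Algebra.norm F t) : V F K) := by
  simp [pt, homCoord, veronese]

theorem mk_pt_injective :
    Function.Injective fun t : Option K => Projectivization.mk F (pt t : V F K) (pt_ne_zero t) := by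
  intro s t h
  obtain ⟨r, hr⟩ := (Projectivization.mk_eq_mk_iff' F _ _ _ _).1 h
  cases s <;> cases t <;> simp only [pt_none, pt_some, Prod.smul_mk, Prod.mk.injEq, smul_eq_mul,
    mul_one, mul_zero, zero_ne_one, false_and] at hr ⊢
  · obtain ⟨rfl, -, -, hr⟩ := hr
    simp at hr
  · obtain ⟨rfl, hr, -⟩ := hr
    rw [← hr, one_smul]

theorem O_eq_range : (O : Set (ℙ F (V F K))) =
    Set.range fun t : Option K => Projectivization.mk F (pt t : V F K) (pt_ne_zero t) := by
  ext p
  simp only [O, Set.mem_union, Set.mem_range, Set.mem_singleton_iff, Option.exists, pt_none,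
    pt_some, pow_add, pow_q, pow_q2]
  rw [or_comm, eq_comm (a := p)]

theorem mk_veronese_mem_O {a c : K} (h : a ≠ 0 ∨ c ≠ 0) :
    Projectivization.mk F (veronese a c : V F K) (veronese_ne_zero h) ∈
      (O : Set (ℙ F (V F K))) := by
  rw [O_eq_range]
  rcases eq_or_ne c 0 with rfl | hc
  · refine ⟨none, ((Projectivization.mk_eq_mk_iff' F _ _ _ _).2 ⟨Algebra.norm F a, ?_⟩).symm⟩
    simp [pt, homCoord, ← veronese_mul]
  · refine ⟨some (a / c), ((Projectivization.mk_eq_mk_iff' F _ _ _ _).2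
      ⟨Algebra.norm F c, ?_⟩).symm⟩
    simp [pt, homCoord, ← veronese_mul, mul_div_cancel₀ _ hc]

theorem exists_GL {a b c d : K} (h : a * d - b * c ≠ 0) :
    ∃ g : GL (Fin 2) K, g 0 0 = a ∧ g 0 1 = b ∧ g 1 0 = c ∧ g 1 1 = d :=
  ⟨Matrix.GeneralLinearGroup.mkOfDetNeZero !![a, b; c, d] (by rwa [Matrix.det_fin_two_of]),
    rfl, rfl, rfl, rfl⟩

theorem GL_det_ne_zero (g : GL (Fin 2) K) : g 0 0 * g 1 1 - g 0 1 * g 1 0 ≠ 0 := by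
  rw [← Matrix.det_fin_two]
  exact (Matrix.isUnits_det_units g).ne_zero

/-- Membership in an orbit of `PGL(2, K)`, in terms of vectors and matrix entries. The scalar `r`
is automatically nonzero, see `ne_zero_of_act_eq_smul`. -/
theorem mem_orbit_iff {u v : V F K} (hu : u ≠ 0) (hv : v ≠ 0) :
    Projectivization.mk F v hv ∈
        MulAction.orbit (Matrix.ProjGenLinGroup (Fin 2) K) (Projectivization.mk F u hu) ↔
      ∃ (a b c d : K) (r : F), a * d - b * c ≠ 0 ∧ act a b c d u = r • v := by
  constructor
  · rintro ⟨g, hg⟩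
    obtain ⟨g, rfl⟩ := Matrix.ProjGenLinGroup.mk_surjective g
    change Matrix.ProjGenLinGroup.mk g • Projectivization.mk F u hu = _ at hg
    rw [mk_smul_mk, Projectivization.mk_eq_mk_iff'] at hg
    obtain ⟨r, hr⟩ := hg
    exact ⟨_, _, _, _, r, GL_det_ne_zero g, hr.symm⟩
  · rintro ⟨a, b, c, d, r, h, H⟩
    obtain ⟨g, rfl, rfl, rfl, rfl⟩ := exists_GL h
    refine ⟨Matrix.ProjGenLinGroup.mk g, ?_⟩
    change Matrix.ProjGenLinGroup.mk g • Projectivization.mk F u hu = _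
    rw [mk_smul_mk, Projectivization.mk_eq_mk_iff']
    exact ⟨r, H.symm⟩

theorem ne_zero_of_act_eq_smul {a b c d : K} (h : a * d - b * c ≠ 0) {u v : V F K} (hu : u ≠ 0)
    {r : F} (H : act a b c d u = r • v) : r ≠ 0 := by
  rintro rfl
  obtain ⟨g, rfl, rfl, rfl, rfl⟩ := exists_GL h
  exact act_ne_zero g hu (by simpa using H)

theorem O_eq_orbit {a c : K} (h : a ≠ 0 ∨ c ≠ 0) : (O : Set (ℙ F (V F K))) =
    MulAction.orbit (Matrix.ProjGenLinGroup (Fin 2) K)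
      (Projectivization.mk F (veronese a c : V F K) (veronese_ne_zero h)) := by
  have key : ∀ p r : K, p ≠ 0 ∨ r ≠ 0 → ∃ b d : K, p * d - b * r ≠ 0 := by
    rintro p r (hp | hr)
    · exact ⟨0, 1, by simpa⟩
    · exact ⟨1, 0, by simpa⟩
  have h1 : (1 : K) ≠ 0 ∨ (0 : K) ≠ 0 := Or.inl one_ne_zero
  have h2 : ∀ p r (h : p ≠ 0 ∨ r ≠ 0),
      Projectivization.mk F (veronese p r : V F K) (veronese_ne_zero h) ∈
        MulAction.orbit (Matrix.ProjGenLinGroup (Fin 2) K)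
          (Projectivization.mk F (veronese (1 : K) 0 : V F K) (veronese_ne_zero h1)) := by
    intro p r h
    obtain ⟨b, d, hbd⟩ := key p r h
    exact (mem_orbit_iff _ _).2 ⟨p, b, r, d, 1, hbd, by simp [act_veronese]⟩
  rw [MulAction.orbit_eq_iff.2 (h2 a c h)]
  apply Set.Subset.antisymm
  · rw [O_eq_range]
    rintro _ ⟨t, rfl⟩
    exact h2 _ _ (homCoord_ne_zero t)
  · rintro _ ⟨g, rfl⟩
    obtain ⟨g, rfl⟩ := Matrix.ProjGenLinGroup.mk_surjective g
    change Matrix.ProjGenLinGroup.mk g • Projectivization.mk F _ _ ∈ _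
    simp only [mk_smul_mk, act_veronese, mul_one, mul_zero, add_zero]
    apply mk_veronese_mem_O
    by_contra! hc
    exact GL_det_ne_zero g (by simp [hc.1, hc.2])

theorem ncard_O : (O : Set (ℙ F (V F K))).ncard = Fintype.card F ^ 3 + 1 := by
  have := finite_extension F K
  have := Fintype.ofFinite K
  rw [O_eq_range, ← Set.image_univ, Set.ncard_image_of_injective _ mk_pt_injective,
    Set.ncard_univ, Nat.card_eq_fintype_card, Fintype.card_option,
    Module.card_eq_pow_finrank (K := F), (Fact.out : Module.finrank F K = 3)]

/-! ### Hyperplane sections of `O` -/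

omit [Fintype F] [Fact (Module.finrank F K = 3)] in
theorem A_smul_left (r : F) (u v : V F K) : A (r • u) v = r * A u v := by
  simp only [A, Prod.smul_fst, Prod.smul_snd, smul_eq_mul, smul_mul_assoc, ← smul_sub, map_smul]
  ring

omit [Fintype F] [Fact (Module.finrank F K = 3)] in
theorem A_smul_right (r : F) (u v : V F K) : A u (r • v) = r * A u v := by
  simp only [A, Prod.smul_fst, Prod.smul_snd, smul_eq_mul, mul_smul_comm, ← smul_sub, map_smul]
  ring

omit [Fintype F] [Fact (Module.finrank F K = 3)] in
theorem mk_mem_perp {u : V F K} (hu : u ≠ 0) (v : V F K) :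
    Projectivization.mk F u hu ∈ perp v ↔ A u v = 0 := by
  constructor
  · rintro ⟨x, hx, h, h0⟩
    obtain ⟨r, rfl⟩ := (Projectivization.mk_eq_mk_iff' F _ _ _ _).1 h
    rw [A_smul_left, h0, mul_zero]
  · exact fun h => ⟨u, hu, rfl, h⟩

omit [Fintype F] [Fact (Module.finrank F K = 3)] in
theorem perp_smul {r : F} (hr : r ≠ 0) (v : V F K) : perp (r • v) = perp v := by
  ext p
  induction p using Projectivization.ind with | _ u hu =>
  simp [mk_mem_perp, A_smul_right, hr]

/-- The number of points of `O` in `v^⊥`. The zero vector is allowed: its perp is the whole of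
`PG(V)`. -/
def sectionCard (v : V F K) : ℕ := (perp v ∩ O).ncard

omit [Fact (Module.finrank F K = 3)] in
theorem sectionCard_smul {r : F} (hr : r ≠ 0) (v : V F K) :
    sectionCard (r • v) = sectionCard v := by
  rw [sectionCard, perp_smul hr, sectionCard]

theorem sectionCard_eq (v : V F K) :
    sectionCard v = Nat.card {t : Option K // A (pt t) v = 0} := by
  rw [sectionCard, O_eq_range, Set.inter_comm, ← Set.image_preimage_eq_range_inter,
    Set.ncard_image_of_injective _ mk_pt_injective, ← Nat.card_coe_set_eq]
  exact Nat.card_congr (Equiv.subtypeEquivRight fun t => mk_mem_perp _ _)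

theorem sectionCard_act {a b c d : K} (h : a * d - b * c ≠ 0) (v : V F K) :
    sectionCard (act a b c d v) = sectionCard v := by
  obtain ⟨g, rfl, rfl, rfl, rfl⟩ := exists_GL h
  have hO : (O : Set (ℙ F (V F K))) = Matrix.ProjGenLinGroup.mk g • O := by
    rw [O_eq_orbit (Or.inl one_ne_zero : (1 : K) ≠ 0 ∨ (0 : K) ≠ 0), MulAction.smul_orbit]
  have hp : perp (act (g 0 0) (g 0 1) (g 1 0) (g 1 1) v) =
      Matrix.ProjGenLinGroup.mk g • perp v := by
    ext p
    rw [Set.mem_smul_set_iff_inv_smul_mem]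
    obtain ⟨p, rfl⟩ : ∃ p', Matrix.ProjGenLinGroup.mk g • p' = p :=
      ⟨(Matrix.ProjGenLinGroup.mk g)⁻¹ • p, smul_inv_smul _ _⟩
    rw [inv_smul_smul]
    induction p using Projectivization.ind with | _ u hu =>
    rw [mk_smul_mk, mk_mem_perp, mk_mem_perp, A_act, mul_eq_zero, Algebra.norm_eq_zero_iff]
    simp [h]
  rw [sectionCard, hO, hp, ← Set.smul_set_inter, sectionCard, Set.ncard_smul_set]

theorem sectionCard_eq_of_mem_orbit {u v : V F K} (hu : u ≠ 0) (hv : v ≠ 0)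
    (h : Projectivization.mk F v hv ∈
      MulAction.orbit (Matrix.ProjGenLinGroup (Fin 2) K) (Projectivization.mk F u hu)) :
    sectionCard v = sectionCard u := by
  obtain ⟨a, b, c, d, r, hdet, H⟩ := (mem_orbit_iff hu hv).1 h
  rw [← sectionCard_smul (ne_zero_of_act_eq_smul hdet hu H), ← H, sectionCard_act hdet]

/-! ### Section numbers of the three explicit representatives -/

variable (F K) in
theorem natCard_extension : Nat.card K = Fintype.card F ^ 3 := by
  rw [Module.natCard_eq_pow_finrank (K := F), (Fact.out : Module.finrank F K = 3),
    Nat.card_eq_fintype_card]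

variable (F K) in
theorem natCard_trace_eq_zero :
    Nat.card {t : K // Algebra.trace F K t = 0} = Fintype.card F ^ 2 := by
  have := finite_extension F K
  have h := (Algebra.trace F K).finrank_range_add_finrank_ker
  rw [LinearMap.range_eq_top.2 (Algebra.trace_surjective F K), finrank_top, Module.finrank_self,
    (Fact.out : Module.finrank F K = 3)] at h
  change Nat.card (LinearMap.ker (Algebra.trace F K)) = _
  rw [Module.natCard_eq_pow_finrank (K := F), Nat.card_eq_fintype_card]
  congr 1
  omega

variable (F K) in
theorem natCard_norm_eq_one :
    Nat.card {t : K // Algebra.norm F t = 1} =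
      Fintype.card F ^ 2 + Fintype.card F + 1 := by
  have := finite_extension F K
  have hs := FiniteField.unitsMap_norm_surjective F K
  have h := Subgroup.card_eq_card_quotient_mul_card_subgroup
    (Units.map (Algebra.norm F : K →* F)).ker
  rw [Nat.card_congr (QuotientGroup.quotientKerEquivOfSurjective _ hs).toEquiv,
    Nat.card_units, Nat.card_units, natCard_extension F K, Nat.card_eq_fintype_card] at h
  have e : {t : K // Algebra.norm F t = 1} ≃ (Units.map (Algebra.norm F : K →* F)).ker :=
    { toFun := fun t => ⟨Units.mk0 t.1 fun h0 => by simpa [h0] using t.2,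
        Units.ext (by simpa using t.2)⟩
      invFun := fun u => ⟨u.1, congrArg Units.val u.2⟩
      left_inv := fun t => rfl
      right_inv := fun u => Subtype.ext (Units.ext rfl) }
  rw [Nat.card_congr e]
  have hq : 1 < Fintype.card F := Fintype.one_lt_card
  generalize Nat.card (Units.map (Algebra.norm F : K →* F)).ker = m at h
  generalize Fintype.card F = q at h hq
  obtain ⟨k, rfl⟩ : ∃ k, q = k + 2 := ⟨q - 2, by omega⟩
  have h3 : (k + 2) ^ 3 - 1 = (k + 2 - 1) * ((k + 2) ^ 2 + (k + 2) + 1) := by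
    rw [Nat.sub_eq_iff_eq_add (Nat.one_le_pow _ _ (by omega)), Nat.add_sub_assoc (by omega : 1 ≤ 2)]
    ring
  exact (Nat.eq_of_mul_eq_mul_left (by omega) (h3.symm.trans h)).symm

theorem sectionCard_e1 :
    sectionCard ((1, 0, 0, 0) : V F K) = 1 := by
  classical
  have := finite_extension F K
  rw [sectionCard_eq, card_subtype_option]
  simp [pt_none, pt_some, A]

theorem sectionCard_e3 :
    sectionCard ((0, 0, 1, 0) : V F K) = Fintype.card F ^ 2 + 1 := by
  classical
  have := finite_extension F K
  rw [sectionCard_eq, card_subtype_option]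
  simp [pt_none, pt_some, A, natCard_trace_eq_zero F K, add_comm]

theorem sectionCard_e1_add_e4 :
    sectionCard ((1, 0, 0, 1) : V F K) = Fintype.card F ^ 2 + Fintype.card F + 1 := by
  classical
  have := finite_extension F K
  rw [sectionCard_eq, card_subtype_option, ← natCard_norm_eq_one F K]
  simp [pt_none, pt_some, A, sub_eq_zero, eq_comm (a := (1 : F))]

/-! ### Stabilizers in `GL(2, K)` -/

/-- The orbit-stabilizer theorem, with the stabilizer taken in `GL(2, K)`: its order is
`(Q² - 1)(Q² - Q)` for `Q = q³`. -/
theorem natCard_orbit_mul {v : V F K} (hv : v ≠ 0) :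
    (MulAction.orbit (Matrix.ProjGenLinGroup (Fin 2) K) (Projectivization.mk F v hv)).ncard *
        Nat.card {g : GL (Fin 2) K //
          ∃ r : F, act (g 0 0) (g 0 1) (g 1 0) (g 1 1) v = r • v} =
      ((Fintype.card F ^ 3) ^ 2 - 1) * ((Fintype.card F ^ 3) ^ 2 - Fintype.card F ^ 3) := by
  have := finite_extension F K
  have := Fintype.ofFinite K
  let _ : MulAction (GL (Fin 2) K) (ℙ F (V F K)) :=
    MulAction.compHom _ (Matrix.ProjGenLinGroup.mk (n := Fin 2) (R := K))
  have horb : MulAction.orbit (Matrix.ProjGenLinGroup (Fin 2) K) (Projectivization.mk F v hv) =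
      MulAction.orbit (GL (Fin 2) K) (Projectivization.mk F v hv) :=
    (Matrix.ProjGenLinGroup.mk_surjective.range_comp fun g => g • Projectivization.mk F v hv).symm
  have hstab : Nat.card {g : GL (Fin 2) K //
      ∃ r : F, act (g 0 0) (g 0 1) (g 1 0) (g 1 1) v = r • v} =
      Nat.card (MulAction.stabilizer (GL (Fin 2) K) (Projectivization.mk F v hv)) := by
    refine Nat.card_congr (Equiv.subtypeEquivRight fun g => ?_)
    rw [MulAction.mem_stabilizer_iff]
    change _ ↔ Matrix.ProjGenLinGroup.mk g • Projectivization.mk F v hv = _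
    rw [mk_smul_mk, Projectivization.mk_eq_mk_iff']
    simp only [eq_comm]
  have hQ := natCard_extension F K
  rw [Nat.card_eq_fintype_card] at hQ
  have hGL := Matrix.card_GL_field (𝔽 := K) 2
  rw [Fin.prod_univ_two, Fin.val_zero, Fin.val_one, pow_zero, pow_one, hQ] at hGL
  rw [horb, hstab, ← Nat.card_coe_set_eq, ← hGL,
    ← Nat.card_prod, Nat.card_congr
      (MulAction.orbitProdStabilizerEquivGroup (GL (Fin 2) K) (Projectivization.mk F v hv))]

omit [Fact (Module.finrank F K = 3)] in
theorem act_e3 (a b c d : K) : act a b c d ((0, 0, 1, 0) : V F K) =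
    (Algebra.trace F K (d * (σ c * σ (σ c))),
      b * (σ c * σ (σ c)) + a * (σ d * σ (σ c) + σ (σ d) * σ c),
      d * (σ a * σ (σ a)) + c * (σ b * σ (σ a) + σ (σ b) * σ a),
      Algebra.trace F K (b * (σ a * σ (σ a)))) := by
  simp only [act, map_zero, mul_zero, zero_add, add_zero, mul_one, pow_add, pow_q,
    pow_q2, zero_pow Fintype.card_ne_zero, zero_pow (pow_ne_zero 2 Fintype.card_ne_zero), map_one]
  refine Prod.ext ?_ (Prod.ext ?_ (Prod.ext ?_ ?_)) <;> dsimp only <;> ring_nf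

omit [Fact (Module.finrank F K = 3)] in
theorem act_e1_add_e4 (a b c d : K) : act a b c d ((1, 0, 0, 1) : V F K) =
    (Algebra.norm F d + Algebra.norm F c, b * (σ d * σ (σ d)) + a * (σ c * σ (σ c)),
      d * (σ b * σ (σ b)) + c * (σ a * σ (σ a)), Algebra.norm F b + Algebra.norm F a) := by
  simp only [act, map_zero, mul_zero, add_zero, mul_one, pow_add, pow_q,
    pow_q2, map_one]
  refine Prod.ext ?_ (Prod.ext ?_ (Prod.ext ?_ ?_)) <;> dsimp only <;> ring_nf

theorem act_e3_eq_smul_iff {a b c d : K} (h : a * d - b * c ≠ 0) :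
    (∃ r : F, act a b c d ((0, 0, 1, 0) : V F K) = r • (0, 0, 1, 0)) ↔
      c = 0 ∧ Algebra.trace F K (b * (σ a * σ (σ a))) = 0 ∧
        ∃ r : F, d * (σ a * σ (σ a)) = algebraMap F K r := by
  simp only [act_e3, Prod.smul_mk, smul_zero, Prod.mk.injEq, Algebra.smul_def (A := K), mul_one]
  constructor
  · rintro ⟨r, h1, h2, h3, h4⟩
    have hc : c = 0 := by
      have h1' := trace_eq (F := F) (d * (σ c * σ (σ c)))
      rw [h1, map_zero] at h1'
      simp only [map_mul, frob_frob_frob] at h1'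
      -- `h2`, multiplied by `c`, is the trace condition `h1'` up to the determinant.
      have : (a * d - b * c) * (σ c * σ (σ c)) = 0 := by
        linear_combination - a * h1' - c * h2
      simpa [h] using this
    refine ⟨hc, h4, r, ?_⟩
    simpa [hc] using h3
  · rintro ⟨rfl, h1, r, hr⟩
    exact ⟨r, by simp, by simp, by simpa using hr, h1⟩

theorem act_e1_add_e4_eq_smul_iff {a b c d : K} (h : a * d - b * c ≠ 0) :
    (∃ r : F, act a b c d ((1, 0, 0, 1) : V F K) = r • (1, 0, 0, 1)) ↔
      (b = 0 ∧ c = 0 ∧ Algebra.norm F a = Algebra.norm F d) ∨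
      (a = 0 ∧ d = 0 ∧ Algebra.norm F b = Algebra.norm F c) := by
  constructor
  · rintro ⟨r, H⟩
    have hr := ne_zero_of_act_eq_smul h (by simp) H
    simp only [act_e1_add_e4, Prod.smul_mk, smul_zero, Prod.mk.injEq, smul_eq_mul, mul_one] at H
    obtain ⟨h1, h2, h3, h4⟩ := H
    have h1' := congrArg (algebraMap F K) h1
    have h2' := congrArg σ h2
    have h2'' := congrArg σ h2'
    simp only [map_add, map_mul, map_zero, norm_eq, frob_frob_frob] at h1' h2' h2''
    -- Multiply the conjugates of `h2` to eliminate `b` from `h3`.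
    have key : σ a * σ (σ a) * c * algebraMap F K r = 0 := by
      linear_combination (-σ a * σ (σ a) * c) * h1' + (d * σ d * σ (σ d)) * h3
        - (σ b * (σ (σ d) * d)) * h2'' + (σ (σ a) * (c * σ c)) * h2'
    simp only [mul_eq_zero, map_eq_zero, hr, or_false, or_self] at key
    rcases key with rfl | rfl
    · have hb : b ≠ 0 := by rintro rfl; simp at h
      have hd : d = 0 := by simpa [hb] using h2
      refine Or.inr ⟨rfl, hd, ?_⟩
      simpa [hd] using h4.trans h1.symm
    · have hd : d ≠ 0 := by rintro rfl; simp at h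
      have hb : b = 0 := by simpa [hd] using h2
      refine Or.inl ⟨hb, rfl, ?_⟩
      simpa [hb] using h4.trans h1.symm
  · simp only [act_e1_add_e4, Prod.smul_mk, smul_zero, Prod.mk.injEq, smul_eq_mul, mul_one]
    rintro (⟨rfl, rfl, hn⟩ | ⟨rfl, rfl, hn⟩)
    · exact ⟨Algebra.norm F d, by simp, by simp, by simp, by simpa using hn⟩
    · exact ⟨Algebra.norm F c, by simp, by simp, by simp, by simpa using hn⟩

theorem norm_div_eq_one {a d : K} (hd : d ≠ 0) (h : Algebra.norm F a = Algebra.norm F d) :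
    Algebra.norm F (a / d) = 1 := by
  have hd' : Algebra.norm F d ≠ 0 := by simpa using hd
  apply mul_right_cancel₀ hd'
  rw [← map_mul, div_mul_cancel₀ _ hd, h, one_mul]

theorem natCard_stabilizer_e3 : Nat.card {g : GL (Fin 2) K //
    ∃ r : F, act (g 0 0) (g 0 1) (g 1 0) (g 1 1) ((0, 0, 1, 0) : V F K) = r • (0, 0, 1, 0)} =
      (Fintype.card F ^ 3 - 1) * ((Fintype.card F - 1) * Fintype.card F ^ 2) := by
  have := finite_extension F K
  rw [← natCard_extension F K, ← natCard_trace_eq_zero F K, ← Nat.card_eq_fintype_card,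
    ← Nat.card_units, ← Nat.card_units, ← Nat.card_prod, ← Nat.card_prod]
  have hN : ∀ a : Kˣ, σ a * σ (σ (a : K)) ≠ 0 := fun a => by simp
  let m : Kˣ × Fˣ × {t : K // Algebra.trace F K t = 0} → GL (Fin 2) K := fun x =>
    Matrix.GeneralLinearGroup.mkOfDetNeZero
      !![(x.1 : K), x.2.2.1 / (σ x.1 * σ (σ (x.1 : K)));
        0, algebraMap F K x.2.1 / (σ x.1 * σ (σ (x.1 : K)))] (by simp)
  symm
  refine Nat.card_eq_of_bijective (fun x => ⟨m x, (act_e3_eq_smul_iff (GL_det_ne_zero _)).2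
    ⟨rfl, ?_, x.2.1, ?_⟩⟩) ⟨?_, ?_⟩
  · exact (congrArg _ (div_mul_cancel₀ _ (hN x.1))).trans x.2.2.2
  · exact div_mul_cancel₀ _ (hN x.1)
  · rintro ⟨a, r, b, hb⟩ ⟨a', r', b', hb'⟩ h
    replace h := congrArg Subtype.val h
    have h0 : (a : K) = a' := congrArg (fun g : GL (Fin 2) K => g 0 0) h
    have h1 : b / (σ a * σ (σ (a : K))) = b' / (σ a' * σ (σ (a' : K))) :=
      congrArg (fun g : GL (Fin 2) K => g 0 1) h
    have h2 : algebraMap F K r / (σ a * σ (σ (a : K))) =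
      algebraMap F K r' / (σ a' * σ (σ (a' : K))) := congrArg (fun g : GL (Fin 2) K => g 1 1) h
    obtain rfl := Units.ext h0
    rw [div_left_inj' (hN a)] at h1 h2
    obtain rfl := h1
    obtain rfl := Units.ext ((algebraMap F K).injective h2)
    rfl
  · rintro ⟨g, hg⟩
    obtain ⟨hc, hb, r, hr⟩ := (act_e3_eq_smul_iff (GL_det_ne_zero g)).1 hg
    have hdet := GL_det_ne_zero g
    rw [hc, mul_zero, sub_zero, mul_ne_zero_iff] at hdet
    have hr0 : r ≠ 0 := by
      rintro rfl
      simp [hdet] at hr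
    refine ⟨(Units.mk0 _ hdet.1, Units.mk0 r hr0, ⟨_, hb⟩), Subtype.ext (Units.ext ?_)⟩
    have hN' := hN (Units.mk0 _ hdet.1)
    rw [Units.val_mk0] at hN'
    ext i j
    fin_cases i <;> fin_cases j
    · rfl
    · exact mul_div_cancel_right₀ _ hN'
    · exact hc.symm
    · change algebraMap F K r / _ = _
      rw [← hr]
      exact mul_div_cancel_right₀ _ hN'

theorem natCard_stabilizer_e1_add_e4 : Nat.card {g : GL (Fin 2) K //
    ∃ r : F, act (g 0 0) (g 0 1) (g 1 0) (g 1 1) ((1, 0, 0, 1) : V F K) = r • (1, 0, 0, 1)} =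
      2 * ((Fintype.card F ^ 3 - 1) * (Fintype.card F ^ 2 + Fintype.card F + 1)) := by
  have := finite_extension F K
  rw [← natCard_extension F K, ← natCard_norm_eq_one F K,
    ← Nat.card_units, ← Nat.card_prod, two_mul, ← Nat.card_sum]
  have hk : ∀ k : {t : K // Algebra.norm F t = 1}, k.1 ≠ 0 := fun k h0 => by
    simpa [h0] using k.2
  let m₁ : Kˣ × {t : K // Algebra.norm F t = 1} → GL (Fin 2) K := fun x =>
    Matrix.GeneralLinearGroup.mkOfDetNeZero !![x.1 * x.2.1, 0; 0, (x.1 : K)] (by simp [hk])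
  let m₂ : Kˣ × {t : K // Algebra.norm F t = 1} → GL (Fin 2) K := fun x =>
    Matrix.GeneralLinearGroup.mkOfDetNeZero !![0, x.1 * x.2.1; (x.1 : K), 0] (by simp [hk])
  symm
  refine Nat.card_eq_of_bijective (Sum.elim
    (fun x => ⟨m₁ x, (act_e1_add_e4_eq_smul_iff (GL_det_ne_zero _)).2 (Or.inl ⟨rfl, rfl, ?_⟩)⟩)
    (fun x => ⟨m₂ x, (act_e1_add_e4_eq_smul_iff (GL_det_ne_zero _)).2 (Or.inr ⟨rfl, rfl, ?_⟩)⟩))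
    ⟨?_, ?_⟩
  · exact (map_mul _ _ _).trans (by rw [x.2.2, mul_one]; rfl)
  · exact (map_mul _ _ _).trans (by rw [x.2.2, mul_one]; rfl)
  · have aux : ∀ (a a' : Kˣ) (k k' : {t : K // Algebra.norm F t = 1}), (a : K) = a' →
        (a : K) * k.1 = a' * k'.1 → (a, k) = (a', k') := by
      rintro a a' ⟨k, hk⟩ ⟨k', hk'⟩ h1 h2
      obtain rfl := Units.ext h1
      obtain rfl := mul_left_cancel₀ a.ne_zero h2
      rfl
    rintro (⟨a, k⟩ | ⟨a, k⟩) (⟨a', k'⟩ | ⟨a', k'⟩) h <;> replace h := congrArg Subtype.val h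
    · exact congrArg Sum.inl (aux _ _ _ _ (congrArg (fun g : GL (Fin 2) K => g 1 1) h)
        (congrArg (fun g : GL (Fin 2) K => g 0 0) h))
    · exact absurd (congrArg (fun g : GL (Fin 2) K => g 1 1) h) a.ne_zero
    · exact absurd (congrArg (fun g : GL (Fin 2) K => g 1 1) h).symm a'.ne_zero
    · exact congrArg Sum.inr (aux _ _ _ _ (congrArg (fun g : GL (Fin 2) K => g 1 0) h)
        (congrArg (fun g : GL (Fin 2) K => g 0 1) h))
  · rintro ⟨g, hg⟩
    have hdet := GL_det_ne_zero g
    obtain ⟨h1, h2, hn⟩ | ⟨h1, h2, hn⟩ := (act_e1_add_e4_eq_smul_iff (GL_det_ne_zero g)).1 hg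
    · rw [h1, zero_mul, sub_zero, mul_ne_zero_iff] at hdet
      refine ⟨Sum.inl (Units.mk0 _ hdet.2, ⟨g 0 0 / g 1 1,
        norm_div_eq_one hdet.2 hn⟩), Subtype.ext (Units.ext ?_)⟩
      ext i j
      fin_cases i <;> fin_cases j
      · exact mul_div_cancel₀ _ hdet.2
      · exact h1.symm
      · exact h2.symm
      · rfl
    · rw [h1, zero_mul, zero_sub, neg_ne_zero, mul_ne_zero_iff] at hdet
      refine ⟨Sum.inr (Units.mk0 _ hdet.2, ⟨g 0 1 / g 1 0,
        norm_div_eq_one hdet.2 hn⟩), Subtype.ext (Units.ext ?_)⟩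
      ext i j
      fin_cases i <;> fin_cases j
      · exact h1.symm
      · exact mul_div_cancel₀ _ hdet.2
      · rfl
      · exact h2.symm

/-! ### Sizes of the orbits -/

theorem ncard_orbit_e3 :
    ((MulAction.orbit (Matrix.ProjGenLinGroup (Fin 2) K)
      (Projectivization.mk F ((0, 0, 1, 0) : V F K) (by simp))).ncard : ℤ) =
      Fintype.card F * (Fintype.card F ^ 2 + Fintype.card F + 1) * (Fintype.card F ^ 3 + 1) := by
  have h := natCard_orbit_mul (F := F) (K := K) (v := (0, 0, 1, 0)) (by simp)
  rw [natCard_stabilizer_e3] at h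
  have hq : 1 < Fintype.card F := Fintype.one_lt_card
  generalize Fintype.card F = q at h hq ⊢
  have hq3 : 1 < q ^ 3 := one_lt_pow₀ hq (by omega)
  zify [hq.le, hq3.le, Nat.one_le_pow 2 _ (one_pos.trans hq3), Nat.le_self_pow two_ne_zero (q ^ 3)]
    at h hq hq3
  have h1 : (q : ℤ) ^ 3 - 1 ≠ 0 := by linarith
  have h2 : (q : ℤ) - 1 ≠ 0 := by linarith
  have h3 : (q : ℤ) ^ 2 ≠ 0 := by positivity
  apply mul_right_cancel₀ (mul_ne_zero h1 (mul_ne_zero h2 h3))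
  rw [h]
  ring

theorem ncard_orbit_e1_add_e4 :
    2 * ((MulAction.orbit (Matrix.ProjGenLinGroup (Fin 2) K)
      (Projectivization.mk F ((1, 0, 0, 1) : V F K) (by simp))).ncard : ℤ) =
      Fintype.card F ^ 3 * (Fintype.card F ^ 3 + 1) * (Fintype.card F - 1) := by
  have h := natCard_orbit_mul (F := F) (K := K) (v := (1, 0, 0, 1)) (by simp)
  rw [natCard_stabilizer_e1_add_e4] at h
  have hq : 1 < Fintype.card F := Fintype.one_lt_card
  generalize Fintype.card F = q at h hq ⊢
  have hq3 : 1 < q ^ 3 := one_lt_pow₀ hq (by omega)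
  zify [hq.le, hq3.le, Nat.one_le_pow 2 _ (one_pos.trans hq3), Nat.le_self_pow two_ne_zero (q ^ 3)]
    at h hq hq3
  have h1 : (q : ℤ) ^ 3 - 1 ≠ 0 := by linarith
  have h3 : (q : ℤ) ^ 2 + q + 1 ≠ 0 := by positivity
  apply mul_right_cancel₀ (mul_ne_zero h1 h3)
  rw [mul_right_comm, mul_comm, mul_comm (2 : ℤ)]
  linear_combination h

/-! ### Moments of the section numbers -/

/-- By 2-transitivity, two distinct points of `O` may be taken to be `⟨(0,0,0,1)⟩` and
`⟨(1,0,0,0)⟩`, where orthogonality is the vanishing of a coordinate. -/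
theorem exists_equiv_pt {s t : Option K} (h : s ≠ t) : ∃ e : V F K ≃ V F K, ∀ v,
    (A (pt s) (e v) = 0 ↔ v.1 = 0) ∧ (A (pt t) (e v) = 0 ↔ v.2.2.2 = 0) := by
  have hdet := homCoord_det_ne_zero h
  obtain ⟨g, h1, h2, h3, h4⟩ := exists_GL hdet
  refine ⟨MulAction.toPerm (rep (F := F) g), fun v => ?_⟩
  have hs : act (g 0 0) (g 0 1) (g 1 0) (g 1 1) (veronese 1 0 : V F K) = pt s := by
    simp [act_veronese, pt, h1, h3]
  have ht : act (g 0 0) (g 0 1) (g 1 0) (g 1 1) (veronese 0 1 : V F K) = pt t := by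
    simp [act_veronese, pt, h2, h4]
  have he : MulAction.toPerm (rep (F := F) g) v = act (g 0 0) (g 0 1) (g 1 0) (g 1 1) v := rfl
  have hg := GL_det_ne_zero g
  rw [he, ← hs, ← ht, A_act, A_act, mul_eq_zero, mul_eq_zero, Algebra.norm_eq_zero_iff,
    veronese_one_zero, veronese_zero_one]
  simp [hg, A]

theorem natCard_isotropic_pt (t : Option K) :
    Nat.card {v : V F K // A (pt t) v = 0} = Fintype.card F ^ 7 := by
  have := finite_extension F K
  obtain ⟨s, hs⟩ := exists_ne t
  obtain ⟨e, he⟩ := exists_equiv_pt (F := F) hs.symm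
  rw [← Nat.card_congr (e.subtypeEquiv fun v => (he v).1.symm)]
  have e' : {v : V F K // v.1 = 0} ≃ K × K × F :=
    { toFun := fun v => v.1.2
      invFun := fun x => ⟨(0, x), rfl⟩
      left_inv := fun v => Subtype.ext (Prod.ext v.2.symm rfl)
      right_inv := fun x => rfl }
  rw [Nat.card_congr e', Nat.card_prod, Nat.card_prod, natCard_extension F K,
    Nat.card_eq_fintype_card]
  ring

theorem natCard_isotropic_pt_pt {s t : Option K} (h : s ≠ t) :
    Nat.card {v : V F K // A (pt s) v = 0 ∧ A (pt t) v = 0} = Fintype.card F ^ 6 := by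
  have := finite_extension F K
  obtain ⟨e, he⟩ := exists_equiv_pt (F := F) h
  rw [← Nat.card_congr (e.subtypeEquiv fun v => (and_congr (he v).1 (he v).2).symm)]
  have e' : {v : V F K // v.1 = 0 ∧ v.2.2.2 = 0} ≃ K × K :=
    { toFun := fun v => (v.1.2.1, v.1.2.2.1)
      invFun := fun x => ⟨(0, x.1, x.2, 0), rfl, rfl⟩
      left_inv := fun v => Subtype.ext
        (Prod.ext v.2.1.symm (Prod.ext rfl (Prod.ext rfl v.2.2.symm)))
      right_inv := fun x => rfl }
  rw [Nat.card_congr e', Nat.card_prod, natCard_extension F K]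
  ring

/-- First moment of the section number: count the pairs `(v, t)` with `A (pt t) v = 0`. -/
theorem sum_sectionCard [Fintype (V F K)] :
    ∑ v : V F K, sectionCard v = (Fintype.card F ^ 3 + 1) * Fintype.card F ^ 7 := by
  classical
  have := finite_extension F K
  have := Fintype.ofFinite K
  simp only [sectionCard_eq, Nat.card_eq_fintype_card, Fintype.card_subtype, Finset.card_filter]
  rw [Finset.sum_comm]
  simp only [← Finset.card_filter, ← Fintype.card_subtype, ← Nat.card_eq_fintype_card,
    natCard_isotropic_pt]
  simp [← Nat.card_eq_fintype_card, natCard_extension F K]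

/-- Second moment of the section number: count the triples `(v, s, t)` for which `v` is orthogonal
to both `pt s` and `pt t`. -/
theorem sum_sectionCard_sq [Fintype (V F K)] :
    ∑ v : V F K, sectionCard v ^ 2 = (Fintype.card F ^ 3 + 1) * Fintype.card F ^ 7 +
      (Fintype.card F ^ 3 + 1) * Fintype.card F ^ 3 * Fintype.card F ^ 6 := by
  classical
  have := finite_extension F K
  have := Fintype.ofFinite K
  have hpair : ∀ s : Option K,
      ∑ t : Option K, Nat.card {v : V F K // A (pt s) v = 0 ∧ A (pt t) v = 0} =
        Fintype.card F ^ 7 + Fintype.card F ^ 3 * Fintype.card F ^ 6 := by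
    intro s
    rw [← Finset.add_sum_erase _ _ (Finset.mem_univ s), Finset.sum_congr rfl fun t ht =>
      natCard_isotropic_pt_pt (Finset.ne_of_mem_erase ht).symm]
    simp only [and_self, natCard_isotropic_pt, Finset.sum_const,
      Finset.card_erase_of_mem (Finset.mem_univ s), Finset.card_univ, Fintype.card_option,
      ← Nat.card_eq_fintype_card (α := K), natCard_extension F K, smul_eq_mul, Nat.add_sub_cancel]
  simp only [sectionCard_eq, Nat.card_eq_fintype_card, Fintype.card_subtype, Finset.card_filter,
    sq, Finset.sum_mul_sum, ← ite_and, mul_ite, mul_one, mul_zero]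
  rw [Finset.sum_comm]
  simp_rw [Finset.sum_comm (s := (Finset.univ : Finset (V F K)))]
  simp only [← Finset.card_filter, ← Fintype.card_subtype, ← Nat.card_eq_fintype_card,
    and_comm, hpair]
  simp [← Nat.card_eq_fintype_card, natCard_extension F K]
  ring

omit [Fact (Module.finrank F K = 3)] in
/-- A sum over `V` of a function that is constant on punctured lines, as a sum over points. -/
theorem sum_eq_sum_projectivization {M : Type*} [AddCommGroup M] [Fintype (V F K)]
    [Fintype (ℙ F (V F K))] (f : V F K → M) (hf : ∀ r : F, r ≠ 0 → ∀ v, f (r • v) = f v) :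
    ∑ v, f v = f 0 + (Fintype.card F - 1) • ∑ p : ℙ F (V F K), f p.rep := by
  classical
  rw [← Finset.add_sum_erase _ _ (Finset.mem_univ (0 : V F K)), ← Finset.card_univ]
  congr 1
  let m : ℙ F (V F K) × Fˣ → V F K := fun x => (x.2 : F) • x.1.rep
  have hm : ∀ x, Projectivization.mk F (m x)
      (smul_ne_zero x.2.ne_zero x.1.rep_nonzero) = x.1 := fun x => by
    conv_rhs => rw [← x.1.mk_rep]
    exact (Projectivization.mk_eq_mk_iff' F _ _ _ _).2 ⟨x.2, rfl⟩
  have hinj : Function.Injective m := by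
    intro x y h
    have h1 : x.1 = y.1 := by
      rw [← hm x, ← hm y]
      congr 1
    have h2 : (x.2 : F) = y.2 := smul_left_injective F x.1.rep_nonzero (by
      change m x = (y.2 : F) • x.1.rep
      rw [h, h1])
    exact Prod.ext h1 (Units.ext h2)
  have himg : (Finset.univ : Finset (V F K)).erase 0 = Finset.univ.image m := by
    ext v
    simp only [Finset.mem_erase, Finset.mem_univ, and_true, Finset.mem_image, true_and]
    constructor
    · intro hv
      obtain ⟨r, hr⟩ := Projectivization.exists_smul_eq_mk_rep F v hv
      refine ⟨(Projectivization.mk F v hv, r⁻¹), ?_⟩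
      change ((r⁻¹ : Fˣ) : F) • _ = _
      rw [← hr, ← Units.smul_def, inv_smul_smul]
    · rintro ⟨x, rfl⟩
      exact smul_ne_zero x.2.ne_zero x.1.rep_nonzero
  rw [himg, Finset.sum_image (hinj.injOn), Fintype.sum_prod_type]
  simp only [m, hf _ (Units.ne_zero _), Finset.sum_const, Finset.card_univ, Fintype.card_units,
    Finset.smul_sum]

/-! ### The complement of the three explicit orbits -/

/-- The orbit of `⟨(0,0,1,0)⟩`. It consists of the points outside `O` that lie in a tangent space
to `O`. -/
def tangentOrbit (F K : Type*) [Field F] [Fintype F] [Field K] [Algebra F K]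
    [Fact (Module.finrank F K = 3)] : Set (ℙ F (V F K)) :=
  MulAction.orbit (Matrix.ProjGenLinGroup (Fin 2) K)
    (Projectivization.mk F ((0, 0, 1, 0) : V F K) (by simp))

/-- The orbit of `⟨(1,0,0,1)⟩`. It consists of the points outside `O` on the lines joining two
points of `O`. -/
def secantOrbit (F K : Type*) [Field F] [Fintype F] [Field K] [Algebra F K]
    [Fact (Module.finrank F K = 3)] : Set (ℙ F (V F K)) :=
  MulAction.orbit (Matrix.ProjGenLinGroup (Fin 2) K)
    (Projectivization.mk F ((1, 0, 0, 1) : V F K) (by simp))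

/-- The points outside the three orbits of `⟨(1,0,0,0)⟩`, `⟨(0,0,1,0)⟩` and `⟨(1,0,0,1)⟩`. They form
a single orbit, see `mem_orbit_of_mem_remainingPoints`. -/
def remainingPoints (F K : Type*) [Field F] [Fintype F] [Field K] [Algebra F K]
    [Fact (Module.finrank F K = 3)] : Set (ℙ F (V F K)) := (O ∪ tangentOrbit F K ∪ secantOrbit F K)ᶜ

theorem O_eq_orbit_e1 : (O : Set (ℙ F (V F K))) =
    MulAction.orbit (Matrix.ProjGenLinGroup (Fin 2) K)
      (Projectivization.mk F ((1, 0, 0, 0) : V F K) (by simp)) := by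
  rw [O_eq_orbit (Or.inr one_ne_zero : (0 : K) ≠ 0 ∨ (1 : K) ≠ 0)]
  simp only [veronese_zero_one]

theorem sectionCard_of_mem_O {v : V F K} (hv : v ≠ 0)
    (h : Projectivization.mk F v hv ∈ (O : Set (ℙ F (V F K)))) : sectionCard v = 1 := by
  rw [O_eq_orbit_e1] at h
  rw [sectionCard_eq_of_mem_orbit _ hv h, sectionCard_e1]

theorem sectionCard_of_mem_tangentOrbit {v : V F K} (hv : v ≠ 0)
    (h : Projectivization.mk F v hv ∈ tangentOrbit F K) :
    sectionCard v = Fintype.card F ^ 2 + 1 := by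
  rw [sectionCard_eq_of_mem_orbit _ hv h, sectionCard_e3]

theorem sectionCard_of_mem_secantOrbit {v : V F K} (hv : v ≠ 0)
    (h : Projectivization.mk F v hv ∈ secantOrbit F K) :
    sectionCard v = Fintype.card F ^ 2 + Fintype.card F + 1 := by
  rw [sectionCard_eq_of_mem_orbit _ hv h, sectionCard_e1_add_e4]

theorem disjoint_O_tangentOrbit : Disjoint (O : Set (ℙ F (V F K))) (tangentOrbit F K) := by
  rw [Set.disjoint_left]
  intro p h1 h2
  induction p using Projectivization.ind with | _ v hv =>
  have := (sectionCard_of_mem_O hv h1).symm.trans (sectionCard_of_mem_tangentOrbit hv h2)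
  have hq := Fintype.card_ne_zero (α := F)
  simp at this

theorem disjoint_O_secantOrbit : Disjoint (O : Set (ℙ F (V F K))) (secantOrbit F K) := by
  rw [Set.disjoint_left]
  intro p h1 h2
  induction p using Projectivization.ind with | _ v hv =>
  have := (sectionCard_of_mem_O hv h1).symm.trans (sectionCard_of_mem_secantOrbit hv h2)
  have hq := Fintype.card_ne_zero (α := F)
  omega

theorem disjoint_tangentOrbit_secantOrbit :
    Disjoint (tangentOrbit F K) (secantOrbit F K) := by
  rw [Set.disjoint_left]
  intro p h1 h2
  induction p using Projectivization.ind with | _ v hv =>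
  have := (sectionCard_of_mem_tangentOrbit hv h1).symm.trans (sectionCard_of_mem_secantOrbit hv h2)
  have hq := Fintype.card_ne_zero (α := F)
  omega

open Classical in
/-- Split a sum over `PG(V)` for a function that is constant on each of the three known orbits. -/
theorem sum_points [Fintype (ℙ F (V F K))] (f : ℙ F (V F K) → ℤ) {x₁ x₂ x₃ : ℤ}
    (h₁ : ∀ p ∈ (O : Set (ℙ F (V F K))), f p = x₁) (h₂ : ∀ p ∈ tangentOrbit F K, f p = x₂)
    (h₃ : ∀ p ∈ secantOrbit F K, f p = x₃) :
    ∑ p, f p = (O : Set (ℙ F (V F K))).ncard * x₁ + (tangentOrbit F K).ncard * x₂ +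
      (secantOrbit F K).ncard * x₃ + ∑ p with p ∈ remainingPoints F K, f p := by
  have hcard : ∀ (S : Set (ℙ F (V F K))) (x : ℤ), S.ncard * x = ∑ p, if p ∈ S then x else 0 := by
    intro S x
    rw [← Finset.sum_filter, Finset.sum_const, ncard_eq_card_filter, nsmul_eq_mul]
  rw [hcard, hcard, hcard, Finset.sum_filter, ← Finset.sum_add_distrib,
    ← Finset.sum_add_distrib, ← Finset.sum_add_distrib]
  refine Finset.sum_congr rfl fun p _ => ?_
  have d₁ : p ∈ (O : Set (ℙ F (V F K))) → p ∉ tangentOrbit F K := fun h =>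
    Set.disjoint_left.1 disjoint_O_tangentOrbit h
  have d₂ : p ∈ (O : Set (ℙ F (V F K))) → p ∉ secantOrbit F K := fun h =>
    Set.disjoint_left.1 disjoint_O_secantOrbit h
  have d₃ : p ∈ tangentOrbit F K → p ∉ secantOrbit F K := fun h =>
    Set.disjoint_left.1 disjoint_tangentOrbit_secantOrbit h
  have hoff : p ∈ remainingPoints F K ↔
    ¬ (p ∈ (O : Set (ℙ F (V F K))) ∨ p ∈ tangentOrbit F K ∨ p ∈ secantOrbit F K) := by
    rw [remainingPoints, Set.mem_compl_iff, Set.mem_union, Set.mem_union, or_assoc]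
  by_cases k₁ : p ∈ (O : Set (ℙ F (V F K)))
  · simp [hoff, k₁, d₁, d₂, h₁]
  by_cases k₂ : p ∈ tangentOrbit F K
  · simp [hoff, k₁, k₂, d₃, h₂]
  by_cases k₃ : p ∈ secantOrbit F K
  · simp [hoff, k₁, k₂, k₃, h₃]
  · simp [hoff, k₁, k₂, k₃]

theorem sectionCard_zero : sectionCard (0 : V F K) = Fintype.card F ^ 3 + 1 := by
  rw [sectionCard, ← ncard_O (K := K)]
  congr 1
  refine Set.inter_eq_right.2 fun p _ => ?_
  induction p using Projectivization.ind with | _ u hu =>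
  simp [mk_mem_perp, A]

variable (F K) in
theorem natCard_V : Nat.card (V F K) = Fintype.card F ^ 8 := by
  rw [Nat.card_prod, Nat.card_prod, Nat.card_prod, natCard_extension F K, Nat.card_eq_fintype_card]
  ring

theorem ncard_remainingPoints : 2 * ((remainingPoints F K).ncard : ℤ) =
    Fintype.card F ^ 3 * (Fintype.card F ^ 3 - 1) * (Fintype.card F + 1) := by
  classical
  have := finite_extension F K
  have := Fintype.ofFinite (ℙ F (V F K))
  have := Fintype.ofFinite (V F K)
  have h := sum_points (F := F) (K := K) (fun _ => 1) (fun _ _ => rfl) (fun _ _ => rfl)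
    (fun _ _ => rfl)
  have hp := Projectivization.card' F (V F K)
  have hq : 1 < Fintype.card F := Fintype.one_lt_card
  have h2 := ncard_orbit_e3 (F := F) (K := K)
  have h3 := ncard_orbit_e1_add_e4 (F := F) (K := K)
  rw [natCard_V, Nat.card_eq_fintype_card, Nat.card_eq_fintype_card] at hp
  rw [← tangentOrbit] at h2
  rw [← secantOrbit] at h3
  rw [ncard_O, h2, Finset.sum_const, Finset.sum_const, Finset.card_univ,
    ← ncard_eq_card_filter] at h
  zify [hq.le] at hp hq
  have h1 : (Fintype.card F : ℤ) - 1 ≠ 0 := by linarith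
  apply mul_left_cancel₀ h1
  push_cast at h
  simp only [nsmul_eq_mul, mul_one] at h
  linear_combination (-2 * (Fintype.card F : ℤ) + 2) * h - 2 * hp -
    ((Fintype.card F : ℤ) - 1) * h3

/-- The sum of `(|p^⊥ ∩ O| - (q² - q + 1))²` over the remaining points vanishes: by the moment
formulas, the rest of the sum over `V` is accounted for by the zero vector and the three known
orbits. -/
theorem sectionCard_of_mem_remainingPoints {v : V F K} (hv : v ≠ 0)
    (h : Projectivization.mk F v hv ∈ remainingPoints F K) :
    (sectionCard v : ℤ) = Fintype.card F ^ 2 - Fintype.card F + 1 := by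
  classical
  have := finite_extension F K
  have := Fintype.ofFinite (ℙ F (V F K))
  have := Fintype.ofFinite (V F K)
  obtain ⟨q, hq⟩ : ∃ q : ℤ, (Fintype.card F : ℤ) = q := ⟨_, rfl⟩
  obtain ⟨c, hc⟩ : ∃ c : ℤ, c = q ^ 2 - q + 1 := ⟨_, rfl⟩
  have hmk : ∀ p : ℙ F (V F K), Projectivization.mk F p.rep p.rep_nonzero = p := fun p => p.mk_rep
  have hsum := sum_points (F := F) (K := K) (fun p => ((sectionCard p.rep : ℤ) - c) ^ 2)
    (x₁ := (1 - c) ^ 2) (x₂ := (q ^ 2 + 1 - c) ^ 2) (x₃ := (q ^ 2 + q + 1 - c) ^ 2)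
    (fun p hp => by
      rw [sectionCard_of_mem_O p.rep_nonzero (by rwa [hmk])]; simp)
    (fun p hp => by
      rw [sectionCard_of_mem_tangentOrbit p.rep_nonzero (by rwa [hmk])]; simp [hq])
    (fun p hp => by
      rw [sectionCard_of_mem_secantOrbit p.rep_nonzero (by rwa [hmk])]; simp [hq])
  have hV := sum_eq_sum_projectivization (F := F) (K := K)
    (fun v => ((sectionCard v : ℤ) - c) ^ 2)
    (fun r hr v => by simp only [sectionCard_smul hr])
  have m1 := congrArg (Nat.cast : ℕ → ℤ) (sum_sectionCard (F := F) (K := K))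
  have m2 := congrArg (Nat.cast : ℕ → ℤ) (sum_sectionCard_sq (F := F) (K := K))
  have m0 := congrArg (Nat.cast : ℕ → ℤ) (natCard_V F K)
  have hq1 : 1 < Fintype.card F := Fintype.one_lt_card
  have h2 := ncard_orbit_e3 (F := F) (K := K)
  have h3 := ncard_orbit_e1_add_e4 (F := F) (K := K)
  rw [← tangentOrbit, hq] at h2
  rw [← secantOrbit, hq] at h3
  rw [Nat.card_eq_fintype_card] at m0
  push_cast [hq] at m0 m1 m2
  rw [hsum, ncard_O, h2] at hV
  obtain ⟨S, hS⟩ : ∃ S : ℤ,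
    ∑ p with p ∈ remainingPoints F K, ((sectionCard p.rep : ℤ) - c) ^ 2 = S := ⟨_, rfl⟩
  rw [hS] at hV
  simp only [sub_sq, Finset.sum_add_distrib, Finset.sum_sub_distrib, ← Finset.sum_mul,
    ← Finset.mul_sum, Finset.sum_const, Finset.card_univ, nsmul_eq_mul, sectionCard_zero,
    Nat.cast_sub hq1.le, m0, m1, m2] at hV
  push_cast [hq] at hV
  have hq0 : q - 1 ≠ 0 := by
    rw [← hq]
    have : (1 : ℤ) < Fintype.card F := by exact_mod_cast hq1
    linarith
  have hS0 : S = 0 := by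
    have : 2 * (q - 1) * S = 0 := by
      rw [hc] at hV
      linear_combination -2 * hV - (q - 1) * (2 * q) ^ 2 * h3
    simpa [hq0] using this
  rw [hS0, Finset.sum_eq_zero_iff_of_nonneg fun _ _ => sq_nonneg _] at hS
  have hp := hS (Projectivization.mk F v hv) (by simpa using h)
  obtain ⟨r, hr⟩ := Projectivization.exists_smul_eq_mk_rep F v hv
  rw [← hr, Units.smul_def, sectionCard_smul r.ne_zero] at hp
  rw [hq, ← hc]
  simpa [sub_eq_zero] using hp

/-! ### Normal forms -/

/-- The affine group fixes `⟨(0,0,0,1)⟩`, and acts as follows on the vectors orthogonal to it. -/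
theorem act_affine (a b y z : K) (w : F) : act a b 0 1 ((0, y, z, w) : V F K) =
    (0, a * y, σ (σ b) * σ a * σ y + σ b * σ (σ a) * σ (σ y) + σ a * σ (σ a) * z,
      Algebra.norm F a * w + Algebra.trace F K (a * (σ b * σ (σ b)) * y +
        b * (σ a * σ (σ a)) * z)) := by
  apply V_ext <;>
  · simp only [act, pow_add, pow_q, pow_q2, map_add, map_mul, trace_eq, norm_eq, map_zero, map_one]
    ring

theorem mk_mem_tangentOrbit {z : K} {w : F} (hz : z ≠ 0) :
    Projectivization.mk F ((0, 0, z, w) : V F K) (by simp [hz]) ∈ tangentOrbit F K := by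
  have := finite_extension F K
  obtain ⟨b, hb⟩ := Algebra.trace_surjective F K w
  exact (mem_orbit_iff _ _).2 ⟨1, b, 0, z, 1, by simpa, by simp [act_e3, hb]⟩

/-- A point whose perp meets `O`, and which is neither in `O` nor tangent, is equivalent to some
`⟨(0,1,z,w)⟩` with `z` and `w` in the small field. -/
theorem exists_normalForm {v : V F K} (hv : v ≠ 0) (hs : sectionCard v ≠ 0)
    (hO : Projectivization.mk F v hv ∉ (O : Set (ℙ F (V F K))))
    (hT : Projectivization.mk F v hv ∉ tangentOrbit F K) :
    ∃ z w : F, Projectivization.mk F ((0, 1, algebraMap F K z, w) : V F K) (by simp) ∈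
      MulAction.orbit (Matrix.ProjGenLinGroup (Fin 2) K) (Projectivization.mk F v hv) := by
  rw [sectionCard_eq] at hs
  obtain ⟨⟨t, ht⟩⟩ : Nonempty {t : Option K // A (pt t) v = 0} := by
    by_contra hne
    rw [not_nonempty_iff] at hne
    exact hs Nat.card_of_isEmpty
  -- Move a point of `O` in `v^⊥` to `⟨(0,0,0,1)⟩`; this makes the first coordinate of `v` vanish.
  obtain ⟨a, b, c, d, hdet, hg⟩ : ∃ a b c d : K, a * d - b * c ≠ 0 ∧
      act a b c d (pt t : V F K) = (0, 0, 0, 1) := by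
    cases t with
    | none => exact ⟨1, 0, 0, 1, by simp, by
        rw [pt, act_veronese]
        simp [homCoord, veronese_one_zero]⟩
    | some t => exact ⟨0, 1, 1, -t, by simp, by
        simp [pt, homCoord, act_veronese, veronese_one_zero]⟩
  have hg' := A_act a b c d (pt t) v
  rw [ht, mul_zero, hg] at hg'
  obtain ⟨⟨x, y, z, w⟩, hu⟩ : ∃ u, u = act a b c d v := ⟨_, rfl⟩
  rw [← hu] at hg'
  obtain rfl : x = 0 := by simpa [A] using hg'
  have hu0 : ((0, y, z, w) : V F K) ≠ 0 := by
    obtain ⟨g, rfl, rfl, rfl, rfl⟩ := exists_GL hdet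
    rw [hu]
    exact act_ne_zero g hv
  have hmem : Projectivization.mk F ((0, y, z, w) : V F K) hu0 ∈
      MulAction.orbit (Matrix.ProjGenLinGroup (Fin 2) K) (Projectivization.mk F v hv) :=
    (mem_orbit_iff _ _).2 ⟨a, b, c, d, 1, hdet, by rw [one_smul, hu]⟩
  have hy : y ≠ 0 := by
    rintro rfl
    rcases eq_or_ne z 0 with rfl | hz
    · apply hO
      rw [O_eq_orbit (Or.inl one_ne_zero : (1 : K) ≠ 0 ∨ (0 : K) ≠ 0)]
      have : Projectivization.mk F ((0, 0, 0, w) : V F K) hu0 =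
          Projectivization.mk F (veronese (1 : K) 0 : V F K)
            (veronese_ne_zero (Or.inl one_ne_zero)) :=
        (Projectivization.mk_eq_mk_iff' F _ _ _ _).2 ⟨w, by simp [veronese_one_zero]⟩
      rw [← this]
      exact MulAction.mem_orbit_symm.1 hmem
    · have := mk_mem_tangentOrbit (F := F) (w := w) hz
      rw [tangentOrbit, ← MulAction.orbit_eq_iff] at this
      apply hT
      rw [tangentOrbit, ← this]
      exact MulAction.mem_orbit_symm.1 hmem
  -- Scaling by `y⁻¹` turns the third coordinate into `b`; translating by this same `b` adds
  -- `σ b + σ (σ b)`, which completes it to the trace of `b`, an element of `F`.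
  obtain ⟨b, hb⟩ : ∃ b, b = σ y⁻¹ * σ (σ y⁻¹) * z := ⟨_, rfl⟩
  refine ⟨Algebra.trace F K b, (act y⁻¹ b 0 1 ((0, y, z, w) : V F K)).2.2.2, ?_⟩
  rw [← MulAction.orbit_eq_iff.2 hmem]
  refine (mem_orbit_iff _ _).2 ⟨y⁻¹, b, 0, 1, 1, by simpa, ?_⟩
  rw [act_affine, one_smul]
  refine Prod.ext rfl (Prod.ext (inv_mul_cancel₀ hy) (Prod.ext ?_ rfl))
  have hy1 : σ y⁻¹ * σ y = 1 := by rw [← map_mul, inv_mul_cancel₀ hy, map_one]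
  have hy2 : σ (σ y⁻¹) * σ (σ y) = 1 := by rw [← map_mul, hy1, map_one]
  dsimp only
  rw [trace_eq, ← hb]
  linear_combination σ (σ b) * hy1 + σ b * hy2

/-- If the quadratic attached to `(0,1,z,w)` has roots `s` and `z - s` in `F`, then `(0,1,z,w)` is
proportional to the difference of the points of `O` with these parameters, or is a tangent vector at
the double root. -/
theorem no_root_of_mem_remainingPoints {z w : F}
    (h : Projectivization.mk F ((0, 1, algebraMap F K z, w) : V F K) (by simp) ∈ remainingPoints F K)
    (s : F) : s ^ 2 - z * s + (z ^ 2 - w) ≠ 0 := by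
  intro hs
  simp only [remainingPoints, Set.mem_compl_iff, Set.mem_union, not_or] at h
  obtain rfl : w = s ^ 2 - z * s + z ^ 2 := by linear_combination -hs
  rcases eq_or_ne (z - s) s with hzs | hzs
  · obtain rfl : z = 2 * s := by linear_combination hzs
    refine h.1.2 ((mem_orbit_iff _ _).2 ⟨algebraMap F K s, 1, 1, 0, 1, by simp, ?_⟩)
    rw [act_e3]
    apply V_ext <;>
    · simp only [one_smul, map_add, map_sub, map_mul, map_pow, trace_eq, AlgHom.commutes, map_zero,
        map_one, map_ofNat]
      ring
  · refine h.2 ((mem_orbit_iff _ _).2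
      ⟨-algebraMap F K (z - s), algebraMap F K s, -1, 1, s - (z - s), ?_, ?_⟩)
    · have : algebraMap F K (s - (z - s)) ≠ 0 := by
        rw [Ne, map_eq_zero, sub_eq_zero]
        exact hzs.symm
      rw [map_sub] at this
      convert this using 1
      ring
    · rw [act_e1_add_e4]
      apply V_ext <;>
      · simp only [Prod.smul_mk]
        simp only [smul_eq_mul, Algebra.smul_def, map_add, map_sub, map_mul, map_pow, map_neg,
          norm_eq, AlgHom.commutes, map_zero, map_one]
        ring

theorem mem_orbit_normalForm {z w z' w' : F}
    (h : ∀ s, s ^ 2 - z * s + (z ^ 2 - w) ≠ 0) (h' : ∀ s, s ^ 2 - z' * s + (z' ^ 2 - w') ≠ 0) :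
    Projectivization.mk F ((0, 1, algebraMap F K z', w') : V F K) (by simp) ∈
      MulAction.orbit (Matrix.ProjGenLinGroup (Fin 2) K)
        (Projectivization.mk F ((0, 1, algebraMap F K z, w) : V F K) (by simp)) := by
  obtain ⟨a, b, ha, h1, h2⟩ := exists_affine_of_irreducible_quadratic h h'
  obtain rfl : w' = z' ^ 2 - (a ^ 2 * (z ^ 2 - w) + a * b * z + b ^ 2) := by
    linear_combination -h2
  subst h1
  refine (mem_orbit_iff _ _).2 ⟨algebraMap F K a, algebraMap F K b, 0, 1, a, by simpa, ?_⟩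
  rw [act_affine]
  apply V_ext <;>
  · simp only [Prod.smul_mk]
    simp only [smul_eq_mul, Algebra.smul_def, map_add, map_sub, map_mul, map_pow, trace_eq,
      norm_eq, AlgHom.commutes, map_zero, map_one, map_ofNat] <;> ring

theorem mem_remainingPoints_of_mem_orbit {p p' : ℙ F (V F K)} (hp : p ∈ remainingPoints F K)
    (h : p' ∈ MulAction.orbit (Matrix.ProjGenLinGroup (Fin 2) K) p) : p' ∈ remainingPoints F K := by
  have key : ∀ x : ℙ F (V F K), p' ∈ MulAction.orbit (Matrix.ProjGenLinGroup (Fin 2) K) x →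
      p ∈ MulAction.orbit (Matrix.ProjGenLinGroup (Fin 2) K) x := by
    intro x hx
    rw [← MulAction.orbit_eq_iff.2 hx]
    exact MulAction.mem_orbit_symm.1 h
  simp only [remainingPoints, O_eq_orbit_e1, tangentOrbit, secantOrbit, Set.mem_compl_iff, Set.mem_union,
    not_or] at hp ⊢
  exact ⟨⟨mt (key _) hp.1.1, mt (key _) hp.1.2⟩, mt (key _) hp.2⟩

theorem mem_orbit_of_mem_remainingPoints {p p' : ℙ F (V F K)} (hp : p ∈ remainingPoints F K)
    (hp' : p' ∈ remainingPoints F K) : p' ∈ MulAction.orbit (Matrix.ProjGenLinGroup (Fin 2) K) p := by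
  have key : ∀ p ∈ remainingPoints F K, ∃ z w : F, (∀ s, s ^ 2 - z * s + (z ^ 2 - w) ≠ 0) ∧
      Projectivization.mk F ((0, 1, algebraMap F K z, w) : V F K) (by simp) ∈
        MulAction.orbit (Matrix.ProjGenLinGroup (Fin 2) K) p := by
    intro p hp
    induction p using Projectivization.ind with | _ v hv =>
    have hs : sectionCard v ≠ 0 := by
      intro h0
      have h1 := sectionCard_of_mem_remainingPoints hv hp
      rw [h0, Nat.cast_zero] at h1
      nlinarith [sq_nonneg ((Fintype.card F : ℤ) - 1)]
    have hp' := hp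
    simp only [remainingPoints, Set.mem_compl_iff, Set.mem_union, not_or] at hp'
    obtain ⟨z, w, h⟩ := exists_normalForm hv hs hp'.1.1 hp'.1.2
    exact ⟨z, w, no_root_of_mem_remainingPoints (mem_remainingPoints_of_mem_orbit hp h), h⟩
  obtain ⟨z, w, h, hu⟩ := key p hp
  obtain ⟨z', w', h', hu'⟩ := key p' hp'
  rw [← MulAction.orbit_eq_iff.2 hu, ← MulAction.orbit_eq_iff.2 (mem_orbit_normalForm h h'),
    MulAction.orbit_eq_iff.2 hu']
  exact MulAction.mem_orbit_self p'

theorem act_mul (k a b c d : K) (v : V F K) :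
    act (k * a) (k * b) (k * c) (k * d) v = Algebra.norm F k • act a b c d v := by
  rw [← act_scalar, act_act]
  simp

/-- A matrix with lower left entry `1` that maps `⟨(0,0,1,0)⟩` to `⟨(1,0,α,α)⟩` has `2 * a = 1` and
`α = -1/4`, so `1/2` is a root of `X² - X - α`. -/
theorem not_act_e3_eq_smul {α : F} (h : ∀ x, x ^ 2 - x - α ≠ 0) {a b d : K} {r : F} (hr : r ≠ 0)
    (H : act a b 1 d ((0, 0, 1, 0) : V F K) = r • (1, 0, algebraMap F K α, α)) : False := by
  have hα : α ≠ 0 := by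
    rintro rfl
    exact h 0 (by simp)
  have hr' : algebraMap F K r ≠ 0 := by simpa using hr
  have hα' : algebraMap F K α ≠ 0 := by simpa using hα
  simp only [act_e3, Prod.smul_mk, Prod.mk.injEq, smul_eq_mul, mul_one, map_one, one_mul,
    Algebra.smul_def (A := K)] at H
  obtain ⟨h1, h2, h3, h4⟩ := H
  replace h1 := congrArg (algebraMap F K) h1
  replace h4 := congrArg (algebraMap F K) h4
  simp only [trace_eq, map_mul, frob_frob_frob] at h1 h4
  obtain rfl : b = a * (d - algebraMap F K r) := by linear_combination h2 - a * h1
  simp only [map_mul, map_sub, AlgHom.commutes] at h3 h4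
  have haa : σ a * σ (σ a) = - algebraMap F K α := by
    apply mul_left_cancel₀ hr'
    linear_combination σ a * σ (σ a) * h1 - h3
  have ha : 2 * a = 1 := by
    apply mul_left_cancel₀ (mul_ne_zero hr' hα')
    linear_combination h4 - a * σ a * σ (σ a) * h1 + 2 * algebraMap F K r * a * haa
  have ha1 := congrArg σ ha
  have ha2 := congrArg σ ha1
  simp only [map_mul, map_ofNat, map_one] at ha1 ha2
  have h4α : 4 * α = -1 := by
    apply (algebraMap F K).injective
    simp only [map_mul, map_ofNat, map_neg, map_one]
    linear_combination 4 * haa - 2 * σ (σ a) * ha1 - ha2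
  have h20 : (2 : F) ≠ 0 := by
    intro h0
    have := congrArg (algebraMap F K) h0
    rw [map_ofNat, map_zero] at this
    rw [this, zero_mul] at ha
    exact zero_ne_one ha
  apply h (1 / 2)
  apply mul_left_cancel₀ (mul_ne_zero h20 h20)
  field_simp
  linear_combination -h4α

/-- A matrix with lower right entry `1` that maps `⟨(1,0,0,1)⟩` to `⟨(1,0,α,α)⟩` has `c = κ * a` with
`κ = 1 - N(c)` in `F`, and `1/κ` is then a root of `X² - X - α`. -/
theorem not_act_e1_add_e4_eq_smul {α : F} (h : ∀ x, x ^ 2 - x - α ≠ 0) {a b c : K} {r : F}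
    (hr : r ≠ 0) (H : act a b c 1 ((1, 0, 0, 1) : V F K) = r • (1, 0, algebraMap F K α, α)) :
    False := by
  have hα : α ≠ 0 := by
    rintro rfl
    exact h 0 (by simp)
  have hr' : algebraMap F K r ≠ 0 := by simpa using hr
  simp only [act_e1_add_e4, Prod.smul_mk, Prod.mk.injEq, smul_eq_mul, mul_one, map_one, one_mul,
    Algebra.smul_def (A := K)] at H
  obtain ⟨h1, h2, h3, h4⟩ := H
  obtain rfl : b = -(a * (σ c * σ (σ c))) := by linear_combination h2
  have h1' := congrArg (algebraMap F K) h1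
  have h4' := congrArg (algebraMap F K) h4
  simp only [map_add, map_mul, map_neg, norm_eq, map_one, frob_frob_frob] at h1' h3 h4'
  have haa : σ a * σ (σ a) * c = algebraMap F K α := by
    apply mul_left_cancel₀ hr'
    linear_combination h3 - σ a * σ (σ a) * c * h1'
  obtain ⟨κ, hκ⟩ : ∃ κ : F, κ = 1 - Algebra.norm F c := ⟨_, rfl⟩
  have hκ' := congrArg (algebraMap F K) hκ
  simp only [map_sub, norm_eq, map_one] at hκ'
  have hNa : algebraMap F K κ * (a * σ a * σ (σ a)) = algebraMap F K α := by
    apply mul_left_cancel₀ hr'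
    rw [hκ']
    linear_combination h4' - (1 - c * σ c * σ (σ c)) * (a * σ a * σ (σ a)) * h1'
  have haa0 : σ a * σ (σ a) ≠ 0 := by
    intro h0
    rw [h0, zero_mul] at haa
    exact hα (by simpa using haa.symm)
  obtain rfl : c = algebraMap F K κ * a := by
    apply mul_left_cancel₀ haa0
    linear_combination haa - hNa
  have hroot : κ = 1 - κ ^ 2 * α := by
    apply (algebraMap F K).injective
    simp only [map_sub, map_mul, map_pow, map_one, AlgHom.commutes] at hκ' ⊢
    linear_combination hκ' - algebraMap F K κ ^ 2 * hNa
  have hκ0 : κ ≠ 0 := by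
    rintro rfl
    simp at hroot
  apply h (1 / κ)
  field_simp
  linear_combination -hroot

theorem mk_mem_remainingPoints {α : F} (h : ∀ x, x ^ 2 - x - α ≠ 0) :
    Projectivization.mk F ((1, 0, algebraMap F K α, α) : V F K) (by simp) ∈ remainingPoints F K := by
  have hα : α ≠ 0 := by
    rintro rfl
    exact h 0 (by simp)
  simp only [remainingPoints, Set.mem_compl_iff, Set.mem_union, not_or]
  refine ⟨⟨?_, ?_⟩, ?_⟩
  · rw [O_eq_range]
    rintro ⟨t, ht⟩
    obtain ⟨r, hr⟩ := (Projectivization.mk_eq_mk_iff' F _ _ _ _).1 ht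
    cases t with
    | none =>
      simp only [pt_none, Prod.smul_mk, Prod.mk.injEq, smul_eq_mul, mul_one] at hr
      simp [hr.1] at hr
    | some t =>
      simp only [pt_some, Prod.smul_mk, Prod.mk.injEq, smul_eq_mul, mul_one, smul_zero] at hr
      obtain ⟨rfl, rfl, -, hr⟩ := hr
      simp [hα] at hr
  · intro hm
    obtain ⟨a, b, c, d, r, hdet, H⟩ := (mem_orbit_iff _ _).1 hm
    have hr := ne_zero_of_act_eq_smul hdet (by simp) H
    have hc : c ≠ 0 := by
      rintro rfl
      simp only [act_e3, Prod.smul_mk, Prod.mk.injEq, map_zero, mul_zero, smul_eq_mul,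
        mul_one] at H
      exact hr H.1.symm
    -- Rescale the matrix so that `c = 1`.
    have H' := act_mul c⁻¹ a b c d ((0, 0, 1, 0) : V F K)
    rw [inv_mul_cancel₀ hc, H, smul_smul] at H'
    exact not_act_e3_eq_smul h (mul_ne_zero (by simpa using hc) hr) H'
  · intro hm
    obtain ⟨a, b, c, d, r, hdet, H⟩ := (mem_orbit_iff _ _).1 hm
    have hr := ne_zero_of_act_eq_smul hdet (by simp) H
    have hd : d ≠ 0 := by
      rintro rfl
      have hc : c ≠ 0 := by
        rintro rfl
        simp at hdet
      simp only [act_e1_add_e4, Prod.smul_mk, Prod.mk.injEq, map_zero, mul_zero, smul_zero,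
        zero_add, mul_eq_zero, map_eq_zero, hc, or_false] at H
      obtain ⟨-, rfl, h3, -⟩ := H
      rw [map_zero, zero_mul, zero_mul, mul_zero, add_zero, eq_comm, smul_eq_zero,
        map_eq_zero] at h3
      exact h3.elim hr hα
    -- Rescale the matrix so that `d = 1`.
    have H' := act_mul d⁻¹ a b c d ((1, 0, 0, 1) : V F K)
    rw [inv_mul_cancel₀ hd, H, smul_smul] at H'
    exact not_act_e1_add_e4_eq_smul h (mul_ne_zero (by simpa using hd) hr) H'

end

end PGLModule

end

open PGLModule in
theorem theorem3p1 {F K : Type*} [Field F] [Fintype F] [Field K] [Algebra F K]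
    [Fact (Module.finrank F K = 3)] (q : ℕ) (hq : Fintype.card F = q) :
    ∃ O₁ O₂ O₃ O₄ : Set (ℙ F (V F K)),
      -- the set of `G`-orbits is `{O₁, O₂, O₃, O₄}`, and the four orbits are distinct
      Set.range (fun p : ℙ F (V F K) => MulAction.orbit (Matrix.ProjGenLinGroup (Fin 2) K) p) =
        {O₁, O₂, O₃, O₄} ∧
      [O₁, O₂, O₃, O₄].Nodup ∧
      -- the shortest orbit
      O₁ = O ∧
      -- sizes
      (O₁.ncard : ℚ) = q ^ 3 + 1 ∧
      (O₂.ncard : ℚ) = q * (q ^ 2 + q + 1) * (q ^ 3 + 1) ∧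
      (O₃.ncard : ℚ) = 1 / 2 * q ^ 3 * (q ^ 3 + 1) * (q - 1) ∧
      (O₄.ncard : ℚ) = 1 / 2 * q ^ 3 * (q ^ 3 - 1) * (q + 1) ∧
      -- representatives
      Projectivization.mk F ((1, 0, 0, 0) : V F K) (by simp) ∈ O₁ ∧
      Projectivization.mk F ((0, 0, 1, 0) : V F K) (by simp) ∈ O₂ ∧
      Projectivization.mk F ((1, 0, 0, 1) : V F K) (by simp) ∈ O₃ ∧
      (∃ α : F, Irreducible (Polynomial.X ^ 2 - Polynomial.X - Polynomial.C α)) ∧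
      (∀ α : F, Irreducible (Polynomial.X ^ 2 - Polynomial.X - Polynomial.C α) →
        Projectivization.mk F ((1, 0, algebraMap F K α, α) : V F K) (by simp) ∈ O₄) ∧
      -- hyperplane sections
      ∀ (v : V F K) (hv : v ≠ 0),
        (Projectivization.mk F v hv ∈ O₁ → ((perp v ∩ O₁).ncard : ℚ) = 1) ∧
        (Projectivization.mk F v hv ∈ O₂ → ((perp v ∩ O₁).ncard : ℚ) = q ^ 2 + 1) ∧
        (Projectivization.mk F v hv ∈ O₃ → ((perp v ∩ O₁).ncard : ℚ) = q ^ 2 + q + 1) ∧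
        (Projectivization.mk F v hv ∈ O₄ → ((perp v ∩ O₁).ncard : ℚ) = q ^ 2 - q + 1) := by
  subst hq
  have hmk : ∀ v : V F K, ∀ hv : v ≠ 0,
      (Projectivization.mk F v hv ∈ (O : Set (ℙ F (V F K))) → ((perp v ∩ O).ncard : ℚ) = 1) ∧
      (Projectivization.mk F v hv ∈ tangentOrbit F K →
        ((perp v ∩ O).ncard : ℚ) = (Fintype.card F : ℚ) ^ 2 + 1) ∧
      (Projectivization.mk F v hv ∈ secantOrbit F K →
        ((perp v ∩ O).ncard : ℚ) = (Fintype.card F : ℚ) ^ 2 + Fintype.card F + 1) ∧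
      (Projectivization.mk F v hv ∈ remainingPoints F K →
        ((perp v ∩ O).ncard : ℚ) = (Fintype.card F : ℚ) ^ 2 - Fintype.card F + 1) := by
    intro v hv
    refine ⟨fun h => ?_, fun h => ?_, fun h => ?_, fun h => ?_⟩
    · exact_mod_cast sectionCard_of_mem_O hv h
    · exact_mod_cast sectionCard_of_mem_tangentOrbit hv h
    · exact_mod_cast sectionCard_of_mem_secantOrbit hv h
    · exact_mod_cast sectionCard_of_mem_remainingPoints hv h
  obtain ⟨α, hα⟩ := exists_irreducible_artinSchreier F
  have hαmem := mk_mem_remainingPoints (K := K) (ne_zero_of_irreducible_artinSchreier hα)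
  have hoff : ∀ p ∈ remainingPoints F K,
      MulAction.orbit (Matrix.ProjGenLinGroup (Fin 2) K) p = remainingPoints F K := fun p hp =>
    Set.Subset.antisymm (fun _ h => mem_remainingPoints_of_mem_orbit hp h)
      (fun _ h => mem_orbit_of_mem_remainingPoints hp h)
  refine ⟨O, tangentOrbit F K, secantOrbit F K, remainingPoints F K, ?_, ?_, rfl, ?_, ?_, ?_, ?_, ?_, ?_,
    ?_, ⟨α, hα⟩, fun α hα => mk_mem_remainingPoints (ne_zero_of_irreducible_artinSchreier hα), hmk⟩
  · ext S
    simp only [Set.mem_range, Set.mem_insert_iff, Set.mem_singleton_iff]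
    constructor
    · rintro ⟨p, rfl⟩
      by_cases hp : p ∈ remainingPoints F K
      · exact Or.inr (Or.inr (Or.inr (hoff p hp)))
      · rw [remainingPoints, Set.notMem_compl_iff] at hp
        rcases hp with (hp | hp) | hp
        · rw [O_eq_orbit_e1] at hp ⊢
          exact Or.inl (MulAction.orbit_eq_iff.2 hp)
        · exact Or.inr (Or.inl (MulAction.orbit_eq_iff.2 hp))
        · exact Or.inr (Or.inr (Or.inl (MulAction.orbit_eq_iff.2 hp)))
    · rintro (rfl | rfl | rfl | rfl)
      · exact ⟨_, O_eq_orbit_e1.symm⟩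
      · exact ⟨_, rfl⟩
      · exact ⟨_, rfl⟩
      · exact ⟨_, hoff _ hαmem⟩
  · have hO : (O : Set (ℙ F (V F K))) ≠ ⊥ :=
      Set.nonempty_iff_ne_empty.1 ⟨_, mk_veronese_mem_O (Or.inl one_ne_zero : (1 : K) ≠ 0 ∨ (0 : K) ≠ 0)⟩
    have hT : tangentOrbit F K ≠ ⊥ :=
      Set.nonempty_iff_ne_empty.1 ⟨_, MulAction.mem_orbit_self _⟩
    have hS : secantOrbit F K ≠ ⊥ :=
      Set.nonempty_iff_ne_empty.1 ⟨_, MulAction.mem_orbit_self _⟩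
    have hd : Disjoint (O ∪ tangentOrbit F K ∪ secantOrbit F K) (remainingPoints F K) :=
      disjoint_compl_right
    rw [Set.disjoint_union_left, Set.disjoint_union_left] at hd
    simp [disjoint_O_tangentOrbit.ne hO, disjoint_O_secantOrbit.ne hO, hd.1.1.ne hO,
      disjoint_tangentOrbit_secantOrbit.ne hT, hd.1.2.ne hT, hd.2.ne hS]
  · rw [ncard_O]
    push_cast
    rfl
  · exact_mod_cast ncard_orbit_e3 (F := F) (K := K)
  · have := congrArg (Int.cast : ℤ → ℚ) (ncard_orbit_e1_add_e4 (F := F) (K := K))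
    push_cast at this
    rw [secantOrbit]
    linear_combination this / 2
  · have := congrArg (Int.cast : ℤ → ℚ) (ncard_remainingPoints (F := F) (K := K))
    push_cast at this
    linear_combination this / 2
  · rw [O_eq_orbit_e1]
    exact MulAction.mem_orbit_self _
  · exact MulAction.mem_orbit_self _
  · exact MulAction.mem_orbit_self _
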